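/- **Theorem 2.** Let $\mathcal S,\mathcal A$ be finite, let an MDP have reward $r:\mathcal S\times\mathcal A\to\mathbb R$ and transition kernel $p(s'\mid s,a)$, and let $\pi$ be a policy inducing a unichain (the state chain with matrix $\sum_a\pi(a\mid s)p(s'\mid s,a)$ has exactly one recurrent class). Let $d_\mu$ be a probability distribution on $\mathcal S\times\mathcal A$ with $d_\mu(s,a)>0$ for all $(s,a)$, let $d_{\mu\pi}$ be the law of $(S,A,R,S',A')$ with $(S,A)\sim d_\mu$, $R=r(S,A)$, $S'\sim p(\cdot\mid S,A)$, $A'\sim\pi(\cdot\mid S')$, and let $\mathbb E$ denote expectation under $d_{\mu\pi}$. Let $x(s,a)\in\mathbb R^K$ be feature vectors such that the matrix $X$ with rows $x(s,a)^\top$ has linearly independent columns. Put $P_\pi((s,a),(s',a'))=p(s'\mid s,a)\pi(a'\mid s')$, $D=\mathrm{diag}(d_\mu)$, $$A_2=X^\top(D-d_\mu d_\mu^\top)(P_\pi-I)X,\quad b_2=X^\top(D-d_\mu d_\mu^\top)r,\quad C_2=X^\top DX,\quad \bar r_w=r+P_\pi Xw-Xw,$$ $$J_{2,\eta}(w)=\|X^\top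 D(\bar r_w-d_\mu^\top\bar r_w\mathbf 1)\|^2_{C_2^{-1}}+\eta\|w\|^2,\qquad \|v\|_B^2=v^\top Bv .$$ A TD fixed point is a pair $(\hat r,w)$ with $\mathbb E[\delta x(S,A)]=0$ and $\mathbb E[\delta]=0$, where $\delta=R-\hat r+x(S',A')^\top w-x(S,A)^\top w$. Let $(S_{k,i},A_{k,i},R_{k,i},S'_{k,i},A'_{k,i})$, $k\ge0$, $i=1,2$, be i.i.d. samples from $d_{\mu\pi}$; write $x_{k,i}=x(S_{k,i},A_{k,i})$, $x'_{k,i}=x(S'_{k,i},A'_{k,i})$. Let $\{\alpha_k\}$ and $\{\beta_k\}$ be positive, deterministic, nonincreasing sequences with $\sum_k\alpha_k=\sum_k\beta_k=\infty$, $\sum_k\alpha_k^2<\infty$, $\sum_k\beta_k^2<\infty$. For $\eta\ge0$ and arbitrary initial values $\nu_0,w_0\in\mathbb R^K$, $\hat r_0\in\mathbb R$, the Diff-GQ2 iterates are, with $\Delta_{k,i}=R_{k,i}+x_{k,i}'^\top w_k-x_{k,i}^\top w_k$, $$\nu_{k+1}=\nu_k+\alpha_k(\Delta_{k,1}-\Delta_{k,2}-x_{k,1}^\top\nu_k)x_{k,1},$$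 $$w_{k+1}=w_k+\alpha_k\big((x_{k,1}-x'_{k,1})-(x_{k,2}-x'_{k,2})\big)x_{k,1}^\top\nu_k-\alpha_k\eta w_k,$$ $$\hat r_{k+1}=\hat r_k+\beta_k\big(\tfrac12(\Delta_{k,1}+\Delta_{k,2})-\hat r_k\big).$$ Then $C_2$ is invertible, and: 1. For every $\eta>0$, $\eta I+A_2^\top C_2^{-1}A_2$ is invertible, $w^*_\eta=-(\eta I+A_2^\top C_2^{-1}A_2)^{-1}A_2^\top C_2^{-1}b_2$ is the unique minimizer of $J_{2,\eta}$, and almost surely $w_k\to w^*_\eta$ and $\hat r_k\to d_\mu^\top(r+P_\pi Xw^*_\eta-Xw^*_\eta)$. 2. The limit $w^*_0=\lim_{\eta\downarrow0}w^*_\eta$ exists and equals $-(C_2^{-1/2}A_2)^\dagger C_2^{-1/2}b_2$ ($\dagger$ the Moore–Penrose pseudoinverse), and there is a constant $U_0$, independent of $\eta$, with $\|w^*_\eta-w^*_0\|\le\eta U_0$ for all $\eta>0$. 3. If a TD fixed point exists, then $A_2w^*_0+b_2=0$. 4. If $A_2$ is invertible, then the unique TD fixed point is given by $w_{\mathrm{TD}}=-A_2^{-1}b_2$,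 $\hat r_{\mathrm{TD}}=d_\mu^\top(r+P_\pi Xw_{\mathrm{TD}}-Xw_{\mathrm{TD}})$, and for $\eta=0$ almost surely $w_k\to w_{\mathrm{TD}}$ and $\hat r_k\to\hat r_{\mathrm{TD}}$. -/

import Mathlib

open MeasureTheory ProbabilityTheory Filter Topology Matrix

noncomputable section

namespace DiffGQ

/-- A finite Markov decision process: a reward `r(s, a)` and a transition kernel `p(s' | s, a)`. -/
structure MDP (S A : Type*) [Fintype S] where
  /-- the reward function -/
  r : S × A → ℝ
  /-- `p (s, a) s'` is the probability of moving to `s'` when action `a` is taken in state `s` -/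
  p : S × A → S → ℝ
  p_nonneg : ∀ sa s', 0 ≤ p sa s'
  p_sum : ∀ sa, ∑ s', p sa s' = 1

/-- A stationary randomized policy; `prob s a` is the probability `π(a | s)`. -/
structure Policy (S A : Type*) [Fintype A] where
  /-- the action probabilities -/
  prob : S → A → ℝ
  prob_nonneg : ∀ s a, 0 ≤ prob s a
  prob_sum : ∀ s, ∑ a, prob s a = 1

section Chain

variable {S : Type*} [Fintype S] [DecidableEq S]

/-- State `t` is accessible from state `s` in the chain with transition matrix `P`. -/
def Accessible (P : Matrix S S ℝ) (s t : S) : Prop := ∃ n : ℕ, 0 < (P ^ n) s t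

/-- In a finite chain a state is recurrent iff it is accessible from every state that is
accessible from it. -/
def IsRecurrent (P : Matrix S S ℝ) (s : S) : Prop :=
  ∀ t, Accessible P s t → Accessible P t s

/-- A finite chain is a unichain if it has exactly one recurrent class (together with a possibly
empty set of transient states). -/
def IsUnichain (P : Matrix S S ℝ) : Prop :=
  (∃ s, IsRecurrent P s) ∧ ∀ s t, IsRecurrent P s → IsRecurrent P t → Accessible P s t

end Chain

section Model

variable {S A : Type*} [Fintype S] [Fintype A] [DecidableEq S] [DecidableEq A] {K : ℕ}

/-- Transition matrix on states of the chain induced by the policy. -/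
def stateMatrix (M : MDP S A) (π : Policy S A) : Matrix S S ℝ :=
  Matrix.of fun s s' => ∑ a, π.prob s a * M.p (s, a) s'

/-- The matrix `P_π((s, a), (s', a')) = p(s' | s, a) π(a' | s')`. -/
def saMatrix (M : MDP S A) (π : Policy S A) : Matrix (S × A) (S × A) ℝ :=
  Matrix.of fun z z' => M.p z z'.1 * π.prob z'.1 z'.2

/-- A sampled tuple `((S, A), (S', A'))`. The sampled reward is `R = r(S, A)`. -/
abbrev Sample (S A : Type*) := (S × A) × (S × A)

/-- The sampling distribution `d_{μπ}`: `(S, A) ∼ d_μ`, `S' ∼ p(· | S, A)`, `A' ∼ π(· | S')`. -/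
def sampleDist (M : MDP S A) (π : Policy S A) (d : S × A → ℝ) (z : Sample S A) : ℝ :=
  d z.1 * (M.p z.1 z.2.1 * π.prob z.2.1 z.2.2)

/-- The temporal difference `R + x'ᵀ w - xᵀ w` of a sample, without the reward-rate term. -/
def tdTerm (M : MDP S A) (x : S × A → Fin K → ℝ) (z : Sample S A) (w : Fin K → ℝ) : ℝ :=
  M.r z.1 + x z.2 ⬝ᵥ w - x z.1 ⬝ᵥ w

/-- `(rhat, w)` is a TD fixed point: `𝔼[δ(w, rhat) x] = 0` and `𝔼[δ(w, rhat)] = 0`, where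
`δ(w, rhat) = R - rhat + x'ᵀ w - xᵀ w` and the expectation is with respect to `d_{μπ}`. -/
def IsTDFixedPoint (M : MDP S A) (π : Policy S A) (d : S × A → ℝ) (x : S × A → Fin K → ℝ)
    (rhat : ℝ) (w : Fin K → ℝ) : Prop :=
  (∑ z : Sample S A, (sampleDist M π d z * (tdTerm M x z w - rhat)) • x z.1) = 0 ∧
    ∑ z : Sample S A, sampleDist M π d z * (tdTerm M x z w - rhat) = 0

/-- The feature matrix `X`, whose row `(s, a)` is `x(s, a)ᵀ`. -/
def featureMatrix (x : S × A → Fin K → ℝ) : Matrix (S × A) (Fin K) ℝ := Matrix.of x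

/-- `A₂ = Xᵀ (D - d_μ d_μᵀ) (P_π - I) X`. -/
def A₂ (M : MDP S A) (π : Policy S A) (d : S × A → ℝ) (x : S × A → Fin K → ℝ) :
    Matrix (Fin K) (Fin K) ℝ :=
  (featureMatrix x)ᵀ * (diagonal d - vecMulVec d d) * (saMatrix M π - 1) * featureMatrix x

/-- `b₂ = Xᵀ (D - d_μ d_μᵀ) r`. -/
def b₂ (M : MDP S A) (d : S × A → ℝ) (x : S × A → Fin K → ℝ) : Fin K → ℝ :=
  ((featureMatrix x)ᵀ * (diagonal d - vecMulVec d d)) *ᵥ M.r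

/-- `C₂ = Xᵀ D X`. -/
def C₂ (d : S × A → ℝ) (x : S × A → Fin K → ℝ) : Matrix (Fin K) (Fin K) ℝ :=
  (featureMatrix x)ᵀ * diagonal d * featureMatrix x

/-- `r̄_w = r + P_π X w - X w`. -/
def rbar (M : MDP S A) (π : Policy S A) (x : S × A → Fin K → ℝ) (w : Fin K → ℝ) : S × A → ℝ :=
  M.r + saMatrix M π *ᵥ (featureMatrix x *ᵥ w) - featureMatrix x *ᵥ w

/-- The reward-rate estimate `d_μᵀ (r + P_π X w - X w)` that belongs to `w`. -/
def rateOf (M : MDP S A) (π : Policy S A) (d : S × A → ℝ) (x : S × A → Fin K → ℝ)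
    (w : Fin K → ℝ) : ℝ :=
  d ⬝ᵥ rbar M π x w

/-- The Euclidean norm of a vector. -/
def l2norm (v : Fin K → ℝ) : ℝ := ‖WithLp.toLp 2 v‖

/-- The objective
`J_{2,η}(w) = ‖Xᵀ D (r̄_w - d_μᵀ r̄_w 𝟏)‖²_{C₂⁻¹} + η ‖w‖²`, where `‖v‖²_B = vᵀ B v`. -/
def J₂ (M : MDP S A) (π : Policy S A) (d : S × A → ℝ) (x : S × A → Fin K → ℝ) (η : ℝ)
    (w : Fin K → ℝ) : ℝ :=
  let v : Fin K → ℝ := (featureMatrix x)ᵀ *ᵥ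
    (diagonal d *ᵥ (rbar M π x w - fun _ => d ⬝ᵥ rbar M π x w))
  v ⬝ᵥ ((C₂ d x)⁻¹ *ᵥ v) + η * l2norm w ^ 2

/-- The matrix `η I + A₂ᵀ C₂⁻¹ A₂`. -/
def regMatrix (M : MDP S A) (π : Policy S A) (d : S × A → ℝ) (x : S × A → Fin K → ℝ) (η : ℝ) :
    Matrix (Fin K) (Fin K) ℝ :=
  η • (1 : Matrix (Fin K) (Fin K) ℝ) + (A₂ M π d x)ᵀ * (C₂ d x)⁻¹ * A₂ M π d x

/-- `w*_η = -(η I + A₂ᵀ C₂⁻¹ A₂)⁻¹ A₂ᵀ C₂⁻¹ b₂`. -/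
def wStar (M : MDP S A) (π : Policy S A) (d : S × A → ℝ) (x : S × A → Fin K → ℝ) (η : ℝ) :
    Fin K → ℝ :=
  -(((regMatrix M π d x η)⁻¹ * (A₂ M π d x)ᵀ * (C₂ d x)⁻¹) *ᵥ b₂ M d x)

/-- `w_TD = -A₂⁻¹ b₂`. -/
def wTD (M : MDP S A) (π : Policy S A) (d : S × A → ℝ) (x : S × A → Fin K → ℝ) : Fin K → ℝ :=
  -((A₂ M π d x)⁻¹ *ᵥ b₂ M d x)

/-- `r̂_TD = d_μᵀ (r + P_π X w_TD - X w_TD)`. -/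
def rTD (M : MDP S A) (π : Policy S A) (d : S × A → ℝ) (x : S × A → Fin K → ℝ) : ℝ :=
  rateOf M π d x (wTD M π d x)

/-- The variables of Diff-GQ2. -/
structure Iterate (K : ℕ) where
  /-- the dual variable -/
  ν : Fin K → ℝ
  /-- the weight vector -/
  w : Fin K → ℝ
  /-- the reward-rate estimate -/
  rhat : ℝ

/-- One step of Diff-GQ2 from the samples `z₁`, `z₂`, with stepsizes `α`, `β` and ridge
parameter `η`. -/
def gq2Step (M : MDP S A) (x : S × A → Fin K → ℝ) (η α β : ℝ) (z₁ z₂ : Sample S A)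
    (c : Iterate K) : Iterate K where
  ν := c.ν + (α * (tdTerm M x z₁ c.w - tdTerm M x z₂ c.w - x z₁.1 ⬝ᵥ c.ν)) • x z₁.1
  w := c.w + (α * (x z₁.1 ⬝ᵥ c.ν)) • ((x z₁.1 - x z₁.2) - (x z₂.1 - x z₂.2)) - (α * η) • c.w
  rhat := c.rhat + β * ((1 / 2) * (tdTerm M x z₁ c.w + tdTerm M x z₂ c.w) - c.rhat)

/-- The Diff-GQ2 iterates for a sequence of sample pairs `z k 0`, `z k 1`. -/
def gq2Iter (M : MDP S A) (x : S × A → Fin K → ℝ) (η : ℝ) (α β : ℕ → ℝ)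
    (z : ℕ → Fin 2 → Sample S A) (init : Iterate K) : ℕ → Iterate K
  | 0 => init
  | k + 1 => gq2Step M x η (α k) (β k) (z k 0) (z k 1) (gq2Iter M x η α β z init k)

end Model

/-- Stepsizes: positive, nonincreasing, `∑ α_k = ∞` and `∑ α_k² < ∞`. -/
structure IsStepsize (α : ℕ → ℝ) : Prop where
  pos : ∀ k, 0 < α k
  antitone : Antitone α
  not_summable : ¬ Summable α
  summable_sq : Summable fun k => α k ^ 2

/-- `N` is the Moore–Penrose pseudoinverse of the real matrix `B`. -/
structure IsMoorePenrose {m n : Type*} [Fintype m] [Fintype n]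
    (B : Matrix m n ℝ) (N : Matrix n m ℝ) : Prop where
  mul_mul_left : B * N * B = B
  mul_mul_right : N * B * N = N
  symm_left : (B * N)ᵀ = B * N
  symm_right : (N * B)ᵀ = N * B

/-- The pairs `z k 0`, `z k 1`, for all `k`, are i.i.d. samples from `d_{μπ}`, defined on a
probability space. -/
structure IsIIDSample {S A Ω : Type*} [Fintype S] [Fintype A]
    [MeasurableSpace S] [MeasurableSpace A] [MeasurableSpace Ω]
    (M : MDP S A) (π : Policy S A) (d : S × A → ℝ) (Pr : Measure Ω)
    (z : ℕ → Fin 2 → Ω → Sample S A) : Prop where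
  measurable : ∀ k i, Measurable (z k i)
  law : ∀ k i t, Pr.real (z k i ⁻¹' {t}) = sampleDist M π d t
  indep : iIndepFun (fun ki : ℕ × Fin 2 => z ki.1 ki.2) Pr

end DiffGQ

end

open DiffGQ

/-!
The centred quantity `Xᵀ D (r̄_w - d_μᵀ r̄_w 𝟏)` equals `A₂ w + b₂` (`A₂_mulVec_add_b₂`), so `J₂` is
a ridge-regression objective with the positive definite weight `C₂⁻¹`. Its minimizer is found by
completing the square (`J₂_wStar_lt`). With `H = C₂^{-1/2}` and `B = H A₂`, the minimizer is
`-(η I + BᵀB)⁻¹ Bᵀ H b₂`, which differs from `-B† H b₂` by `O(η)` because the columns of `B†` lie in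
the range of `BᵀB` (`l2norm_ridge_sub_le`). A TD fixed point is a solution of `A₂ w + b₂ = 0`
together with its reward rate (`isTDFixedPoint_iff`); if there is one, `H b₂` lies in the range of
`B`, and the pseudoinverse solves the equation exactly.

For the iterates, `(νₖ, wₖ)` is a random affine recursion whose mean field is
`(A₂ w + b₂ - C₂ ν, -A₂ᵀ ν - η w)` (`sum_pairDist_gq2Drift`): drawing two independent samples makes
the products of expectations in `A₂` and `b₂` unbiased. The mean field vanishes at
`(C₂⁻¹ (A₂ w + b₂), w)` for the claimed limit `w`. Around that zero its linear part is
`[-C₂, A₂; -A₂ᵀ, -η I]`, whose skew part drops out of `|ν|² + |w|²`; for `η > 0` this is a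
Lyapunov function, and for `η = 0` with `A₂` invertible one subtracts a small multiple of
`⟪ν, A₂ w⟫` (`exists_lyapunov`). The sample space is finite, so all constants are uniform, and a
Robbins–Siegmund argument (`ae_tendsto_zero_of_condExp_le`, `ae_tendsto_zero_of_linear`) gives
almost sure convergence.

The reward-rate estimate has its own stepsizes. It splits into the same recursion run with `w`
frozen at its limit, a scalar linear stochastic approximation with i.i.d. noise, and a pathwise
averaging of the null sequence caused by `wₖ - w` (`tendsto_zero_of_averaging`).
-/

open MeasureTheory ProbabilityTheory Filter Topology Matrix
open DiffGQ

/-! ### The Robbins–Siegmund lemma -/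

/-- If `v` converges and `∑ αₖ vₖ < ∞` while `∑ αₖ = ∞`, then `v → 0`. -/
theorem tendsto_zero_of_summable_mul {α v : ℕ → ℝ} (hα : ∀ k, 0 ≤ α k) (hdiv : ¬ Summable α)
    (hv : ∀ k, 0 ≤ v k) (hs : Summable fun k => α k * v k) {l : ℝ} (hl : Tendsto v atTop (𝓝 l)) :
    Tendsto v atTop (𝓝 0) := by
  have hl0 : 0 ≤ l := ge_of_tendsto' hl hv
  rcases hl0.eq_or_lt with h | h
  · rwa [h]
  exfalso
  apply hdiv
  have hev : ∀ᶠ k in atTop, l / 2 < v k := hl.eventually (lt_mem_nhds (by linarith))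
  have h2 : Summable fun k => (2 / l) * (α k * v k) := hs.mul_left _
  refine Summable.of_norm_bounded_eventually_nat h2 ?_
  filter_upwards [hev] with k hk
  rw [Real.norm_of_nonneg (hα k)]
  have : α k * (l / 2) ≤ α k * v k := mul_le_mul_of_nonneg_left hk.le (hα k)
  calc α k = 2 / l * (α k * (l / 2)) := by field_simp
    _ ≤ _ := by gcongr

/-- The products `∏ (1 + aⱼ)` of a nonnegative summable sequence converge. -/
theorem exists_tendsto_prod_one_add {a : ℕ → ℝ} (ha : ∀ k, 0 ≤ a k) (hs : Summable a) :
    ∃ l, Tendsto (fun k => ∏ j ∈ Finset.range k, (1 + a j)) atTop (𝓝 l) :=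
  have h : Summable fun k => ‖a k‖ := by simpa [abs_of_nonneg, ha] using hs
  ⟨_, (multipliable_one_add_of_summable h).hasProd.tendsto_prod_nat⟩

section RobbinsSiegmund

variable {Ω : Type*} {m0 : MeasurableSpace Ω} {μ : Measure Ω}

/-- A Robbins–Siegmund lemma. Dividing `Vₖ + 1` by `∏_{j<k} (1 + C αⱼ²)` gives a nonnegative
supermartingale, so `Vₖ` converges almost surely; the drift terms telescope to `∑ αₖ 𝔼 Vₖ < ∞`,
which forces the limit to be `0` because `∑ αₖ = ∞`. -/
theorem ae_tendsto_zero_of_condExp_le [IsProbabilityMeasure μ] {ℱ : Filtration ℕ m0}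
    {V : ℕ → Ω → ℝ} (hadp : StronglyAdapted ℱ V) (hint : ∀ k, Integrable (V k) μ)
    (hV : ∀ k ω, 0 ≤ V k ω) {α : ℕ → ℝ} (hα : IsStepsize α) {c C : ℝ} (hc : 0 < c) (hC : 0 ≤ C)
    (hstep : ∀ k, μ[V (k + 1) | ℱ k] ≤ᵐ[μ]
      fun ω => (1 - c * α k + C * α k ^ 2) * V k ω + C * α k ^ 2) :
    ∀ᵐ ω ∂μ, Tendsto (fun k => V k ω) atTop (𝓝 0) := by
  set Γ : ℕ → ℝ := fun k => ∏ j ∈ Finset.range k, (1 + C * α j ^ 2) with hΓ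
  have hfac : ∀ j, 1 ≤ 1 + C * α j ^ 2 := fun j => by
    have := mul_nonneg hC (sq_nonneg (α j)); linarith
  have hΓ1 : ∀ k, 1 ≤ Γ k := fun k =>
    Finset.prod_induction _ (1 ≤ ·) (fun _ _ => one_le_mul_of_one_le_of_one_le) le_rfl
      fun j _ => hfac j
  have hΓ0 : ∀ k, 0 < Γ k := fun k => zero_lt_one.trans_le (hΓ1 k)
  have hΓs : ∀ k, Γ (k + 1) = Γ k * (1 + C * α k ^ 2) := fun k => Finset.prod_range_succ _ _
  obtain ⟨L, hL⟩ : ∃ l, Tendsto Γ atTop (𝓝 l) :=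
    exists_tendsto_prod_one_add (fun k => mul_nonneg hC (sq_nonneg _))
      (hα.summable_sq.mul_left C)
  have hΓmono : Monotone Γ := monotone_nat_of_le_succ fun k => by
    rw [hΓs]; exact le_mul_of_one_le_right (hΓ0 k).le (hfac k)
  have hΓL : ∀ k, Γ k ≤ L := hΓmono.ge_of_tendsto hL
  set W : ℕ → Ω → ℝ := fun k => (Γ k)⁻¹ • (V k + fun _ => (1 : ℝ)) with hW
  have hWapp : ∀ k ω, W k ω = (Γ k)⁻¹ * (V k ω + 1) := fun k ω => rfl
  have hW0 : ∀ k ω, 0 ≤ W k ω := fun k ω =>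
    mul_nonneg (inv_nonneg.2 (hΓ0 k).le) (add_nonneg (hV k ω) zero_le_one)
  have hWint : ∀ k, Integrable (W k) μ := fun k => ((hint k).add (integrable_const 1)).smul _
  have hWadp : StronglyAdapted ℱ W := fun k => ((hadp k).add stronglyMeasurable_const).const_smul _
  have hWstep : ∀ k, μ[W (k + 1) | ℱ k] ≤ᵐ[μ] fun ω => W k ω - c * α k / Γ (k + 1) * V k ω := by
    intro k
    have h1 : μ[W (k + 1) | ℱ k] =ᵐ[μ] (Γ (k + 1))⁻¹ • μ[V (k + 1) + fun _ => (1 : ℝ) | ℱ k] :=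
      condExp_smul _ _ _
    have h2 : μ[V (k + 1) + fun _ => (1 : ℝ) | ℱ k] =ᵐ[μ]
        μ[V (k + 1) | ℱ k] + μ[fun _ => (1 : ℝ) | ℱ k] :=
      condExp_add (hint _) (integrable_const _) _
    filter_upwards [h1, h2, hstep k] with ω h1 h2 h3
    rw [h1, Pi.smul_apply, h2, Pi.add_apply, condExp_const (ℱ.le k), hWapp, smul_eq_mul]
    have hp := hΓ0 k
    have hf := zero_lt_one.trans_le (hfac k)
    calc (Γ (k + 1))⁻¹ * (μ[V (k + 1) | ℱ k] ω + 1)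
        ≤ (Γ (k + 1))⁻¹ * ((1 + C * α k ^ 2) * (V k ω + 1) - c * α k * V k ω) := by
          refine mul_le_mul_of_nonneg_left ?_ (inv_nonneg.2 (hΓ0 _).le)
          linarith
      _ = _ := by
          rw [hΓs]; field_simp
  have hsuper : Supermartingale W ℱ μ := supermartingale_nat hWadp hWint fun k => by
    filter_upwards [hWstep k] with ω h
    refine h.trans (sub_le_self _ (mul_nonneg (div_nonneg ?_ (hΓ0 _).le) (hV k ω)))
    exact mul_nonneg hc.le (hα.pos k).le
  have hEstep : ∀ k, ∫ ω, W (k + 1) ω ∂μ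
      ≤ ∫ ω, W k ω ∂μ - c * α k / Γ (k + 1) * ∫ ω, V k ω ∂μ := by
    intro k
    rw [← integral_condExp (ℱ.le k), ← integral_const_mul,
      ← integral_sub (hWint k) ((hint k).const_mul _)]
    exact integral_mono_ae integrable_condExp ((hWint k).sub ((hint k).const_mul _)) (hWstep k)
  have hE0 : ∀ k, 0 ≤ ∫ ω, V k ω ∂μ := fun k => integral_nonneg (hV k)
  have hEsum : ∀ n, ∑ k ∈ Finset.range n, α k * ∫ ω, V k ω ∂μ
      ≤ L / c * (∫ ω, W 0 ω ∂μ - ∫ ω, W n ω ∂μ) := by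
    intro n
    induction n with
    | zero => simp
    | succ n ih =>
      rw [Finset.sum_range_succ]
      have h1 := hEstep n
      have hL0 : 0 < L := (hΓ0 0).trans_le (hΓL 0)
      have h2 : α n * ∫ ω, V n ω ∂μ ≤ L / c * (c * α n / Γ (n + 1) * ∫ ω, V n ω ∂μ) := by
        have : L / c * (c * α n / Γ (n + 1) * ∫ ω, V n ω ∂μ)
            = L / Γ (n + 1) * (α n * ∫ ω, V n ω ∂μ) := by field_simp
        rw [this]
        refine le_mul_of_one_le_left (mul_nonneg (hα.pos n).le (hE0 n)) ?_
        rw [one_le_div (hΓ0 _)]; exact hΓL _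
      have h3 : L / c * (c * α n / Γ (n + 1) * ∫ ω, V n ω ∂μ)
          ≤ L / c * (∫ ω, W n ω ∂μ - ∫ ω, W (n + 1) ω ∂μ) :=
        mul_le_mul_of_nonneg_left (by linarith) (div_pos hL0 hc).le
      calc _ ≤ _ := add_le_add ih (h2.trans h3)
        _ = _ := by ring
  have hsumE : Summable fun k => α k * ∫ ω, V k ω ∂μ := by
    refine summable_of_sum_range_le (c := L / c * ∫ ω, W 0 ω ∂μ)
      (fun k => mul_nonneg (hα.pos k).le (hE0 k)) fun n => (hEsum n).trans ?_
    have hL0 : 0 < L := (hΓ0 0).trans_le (hΓL 0)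
    refine mul_le_mul_of_nonneg_left ?_ (div_pos hL0 hc).le
    exact sub_le_self _ (integral_nonneg (hW0 n))
  have hsum : ∀ᵐ ω ∂μ, Summable fun k => α k * V k ω := by
    have hi : ∀ k, Integrable (fun ω => α k * V k ω) μ := fun k => (hint k).const_mul _
    have hnn : ∀ k ω, 0 ≤ α k * V k ω := fun k ω => mul_nonneg (hα.pos k).le (hV k ω)
    have hfin : ∫⁻ ω, ∑' k, ENNReal.ofReal (α k * V k ω) ∂μ ≠ ⊤ := by
      rw [lintegral_tsum fun k => (hi k).aestronglyMeasurable.aemeasurable.ennreal_ofReal]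
      have : ∀ k, ∫⁻ ω, ENNReal.ofReal (α k * V k ω) ∂μ = ENNReal.ofReal (α k * ∫ ω, V k ω ∂μ) :=
        fun k => by
          rw [← ofReal_integral_eq_lintegral_ofReal (hi k) (ae_of_all _ (hnn k)),
            integral_const_mul]
      simp_rw [this]
      exact hsumE.tsum_ofReal_ne_top
    have hm : AEMeasurable (fun ω => ∑' k, ENNReal.ofReal (α k * V k ω)) μ :=
      AEMeasurable.tsum fun k => (hi k).aestronglyMeasurable.aemeasurable.ennreal_ofReal
    filter_upwards [ae_lt_top' hm hfin] with ω hω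
    have := ENNReal.summable_toReal hω.ne
    simpa [ENNReal.toReal_ofReal (hnn _ ω)] using this
  have hbdd : ∀ n, eLpNorm ((-W) n) 1 μ ≤ (∫ ω, W 0 ω ∂μ).toNNReal := by
    intro n
    rw [Pi.neg_apply, eLpNorm_neg, eLpNorm_one_eq_lintegral_enorm]
    have h1 : ∫⁻ ω, ‖W n ω‖ₑ ∂μ = ENNReal.ofReal (∫ ω, W n ω ∂μ) := by
      rw [ofReal_integral_eq_lintegral_ofReal (hWint n) (ae_of_all _ (hW0 n))]
      refine lintegral_congr fun ω => ?_
      rw [Real.enorm_eq_ofReal (hW0 n ω)]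
    rw [h1]
    refine ENNReal.ofReal_le_ofReal ?_
    have := hsuper.setIntegral_le (Nat.zero_le n) MeasurableSet.univ
    simpa using this
  filter_upwards [hsum, hsuper.neg.exists_ae_tendsto_of_bdd hbdd] with ω h1 ⟨l, h2⟩
  have h3 : Tendsto (fun k => V k ω) atTop (𝓝 (L * -l - 1)) := by
    refine ((hL.mul h2.neg).sub_const 1).congr fun k => ?_
    have := (hΓ0 k).ne'
    simp only [Pi.neg_apply, hWapp]
    field_simp
    ring
  exact tendsto_zero_of_summable_mul (fun k => (hα.pos k).le) hα.not_summable
    (fun k => hV k ω) h1 h3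

end RobbinsSiegmund

/-! ### Random recursions driven by samples from a finite set -/

section RandomRecursion

variable {Ω T E : Type*} [Fintype T]

/-- The random recursion `y (k + 1) = step k (z k) (y k)` started at `y₀`. -/
def randomRec (step : ℕ → T → E → E) (y₀ : E) (z : ℕ → T) : ℕ → E
  | 0 => y₀
  | k + 1 => step k (z k) (randomRec step y₀ z k)

variable {z : ℕ → Ω → T} (step : ℕ → T → E → E) (y₀ : E)

theorem randomRec_succ_eq_sum (V : E → ℝ) (k : ℕ) (ω : Ω) :
    V (randomRec step y₀ (fun j => z j ω) (k + 1)) =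
      ∑ t, V (step k t (randomRec step y₀ (fun j => z j ω) k)) *
        (z k ⁻¹' {t}).indicator (fun _ => (1 : ℝ)) ω := by
  rw [Finset.sum_eq_single (z k ω)]
  · simp [randomRec]
  · intro t _ ht
    rw [Set.indicator_of_notMem (by simpa using ht.symm), mul_zero]
  · simp

/-- At a fixed time the recursion takes finitely many values, so no growth
condition on `V` is needed. -/
theorem randomRec_bounded (V : E → ℝ) (k : ℕ) :
    ∃ B, ∀ ω, |V (randomRec step y₀ (fun j => z j ω) k)| ≤ B := by
  induction k generalizing V with
  | zero => exact ⟨|V y₀|, fun _ => le_rfl⟩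
  | succ k ih =>
    choose B hB using fun t => ih fun y => V (step k t y)
    refine ⟨∑ t, |B t|, fun ω => ?_⟩
    exact (hB (z k ω) ω).trans ((le_abs_self _).trans
      (Finset.single_le_sum (f := fun t => |B t|) (fun t _ => abs_nonneg _) (Finset.mem_univ _)))

variable {m0 : MeasurableSpace Ω} {μ : Measure Ω} {ℱ : Filtration ℕ m0}
  [MeasurableSpace T] [MeasurableSingletonClass T]

theorem randomRec_measurable (hz : ∀ k, Measurable[ℱ (k + 1)] (z k)) (V : E → ℝ) (k : ℕ) :
    Measurable[ℱ k] fun ω => V (randomRec step y₀ (fun j => z j ω) k) := by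
  induction k generalizing V with
  | zero => exact measurable_const (a := V y₀)
  | succ k ih =>
    simp_rw [randomRec_succ_eq_sum]
    refine Finset.measurable_sum _ fun t _ => Measurable.mul ?_ ?_
    · exact (ih fun y => V (step k t y)).mono (ℱ.mono k.le_succ) le_rfl
    · exact measurable_const.indicator (hz k (measurableSet_singleton t))

theorem randomRec_integrable [IsFiniteMeasure μ] (hz : ∀ k, Measurable[ℱ (k + 1)] (z k))
    (V : E → ℝ) (k : ℕ) :
    Integrable (fun ω => V (randomRec step y₀ (fun j => z j ω) k)) μ := by
  obtain ⟨B, hB⟩ := randomRec_bounded (z := z) step y₀ V k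
  exact Integrable.of_bound
    (((randomRec_measurable step y₀ hz V k).mono (ℱ.le k) le_rfl).aestronglyMeasurable)
    B (ae_of_all _ hB)

theorem condExp_randomRec_succ [IsProbabilityMeasure μ]
    (hz : ∀ k, Measurable[ℱ (k + 1)] (z k))
    (hindep : ∀ k, Indep (MeasurableSpace.comap (z k) inferInstance) (ℱ k) μ)
    (V : E → ℝ) (k : ℕ) :
    μ[fun ω => V (randomRec step y₀ (fun j => z j ω) (k + 1)) | ℱ k] =ᵐ[μ]
      fun ω => ∑ t, μ.real (z k ⁻¹' {t}) * V (step k t (randomRec step y₀ (fun j => z j ω) k)) := by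
  set F : T → Ω → ℝ := fun t ω => V (step k t (randomRec step y₀ (fun j => z j ω) k)) with hF
  set G : T → Ω → ℝ := fun t => (z k ⁻¹' {t}).indicator (fun _ => (1 : ℝ)) with hG
  have hzk : Measurable (z k) := (hz k).mono (ℱ.le _) le_rfl
  have hset : ∀ t, MeasurableSet (z k ⁻¹' {t}) := fun t => hzk (measurableSet_singleton t)
  have hGint : ∀ t, Integrable (G t) μ := fun t => (integrable_const 1).indicator (hset t)
  have hFm : ∀ t, Measurable[ℱ k] (F t) := fun t =>
    randomRec_measurable step y₀ hz (fun y => V (step k t y)) k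
  have hB : ∀ t, ∃ B, ∀ ω, |F t ω| ≤ B := fun t =>
    randomRec_bounded step y₀ (fun y => V (step k t y)) k
  have hFG : ∀ t, Integrable (F t * G t) μ := fun t => by
    obtain ⟨B, hB⟩ := hB t
    exact (hGint t).bdd_mul ((hFm t).mono (ℱ.le k) le_rfl).aestronglyMeasurable (ae_of_all _ hB)
  have h0 : (fun ω => V (randomRec step y₀ (fun j => z j ω) (k + 1))) = ∑ t, F t * G t := by
    funext ω
    rw [randomRec_succ_eq_sum step y₀ V k ω, Finset.sum_apply]
    rfl
  rw [h0]
  have h1 : ∀ t, μ[F t * G t | ℱ k] =ᵐ[μ] fun ω => μ.real (z k ⁻¹' {t}) * F t ω := fun t => by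
    have h2 := condExp_mul_of_stronglyMeasurable_left (hFm t).stronglyMeasurable (hFG t) (hGint t)
    have hGm : Measurable[MeasurableSpace.comap (z k) inferInstance] (G t) :=
      measurable_const.indicator ⟨{t}, measurableSet_singleton t, rfl⟩
    have h3 : μ[G t | ℱ k] =ᵐ[μ] fun _ => μ[G t] :=
      condExp_indep_eq hzk.comap_le (ℱ.le k) hGm.stronglyMeasurable (hindep k)
    filter_upwards [h2, h3] with ω h2 h3
    rw [h2, Pi.mul_apply, h3, hG, integral_indicator_const _ (hset t)]
    simp [mul_comm]
  have h4 := condExp_finsetSum (s := Finset.univ) (fun t _ => hFG t) (ℱ k)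
  filter_upwards [h4, ae_all_iff.2 h1] with ω h4 h1
  rw [h4, Finset.sum_apply]
  exact Finset.sum_congr rfl fun t _ => h1 t

/-- A Lyapunov criterion for stochastic approximation: if, on average over one sample, `V` contracts
by `c αₖ` up to relative and absolute errors of order `αₖ²`, then it tends to `0`. -/
theorem ae_tendsto_zero_of_lyapunov [IsProbabilityMeasure μ]
    (hz : ∀ k, Measurable[ℱ (k + 1)] (z k))
    (hindep : ∀ k, Indep (MeasurableSpace.comap (z k) inferInstance) (ℱ k) μ)
    {p : T → ℝ} (hp : ∀ k t, μ.real (z k ⁻¹' {t}) = p t)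
    {V : E → ℝ} (hV : ∀ y, 0 ≤ V y) {α : ℕ → ℝ} (hα : IsStepsize α) {c C : ℝ} (hc : 0 < c)
    (hC : 0 ≤ C)
    (hstep : ∀ k y, ∑ t, p t * V (step k t y) ≤ (1 - c * α k + C * α k ^ 2) * V y + C * α k ^ 2) :
    ∀ᵐ ω ∂μ, Tendsto (fun k => V (randomRec step y₀ (fun j => z j ω) k)) atTop (𝓝 0) := by
  refine ae_tendsto_zero_of_condExp_le (ℱ := ℱ)
    (V := fun k ω => V (randomRec step y₀ (fun j => z j ω) k))
    (fun k => (randomRec_measurable step y₀ hz V k).stronglyMeasurable)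
    (fun k => randomRec_integrable step y₀ hz V k) (fun k ω => hV _) hα hc hC fun k => ?_
  filter_upwards [condExp_randomRec_succ step y₀ hz hindep V k] with ω h
  rw [h]
  simp_rw [hp]
  exact hstep k _

end RandomRecursion

/-! ### Linear stochastic approximation -/

/-- Two continuous functions that are homogeneous of degree two on a finite-dimensional space can
be compared as soon as the larger one is positive off `0`, by compactness of the unit sphere. -/
theorem exists_le_mul_of_homogeneous {E : Type*} [NormedAddCommGroup E] [NormedSpace ℝ E]
    [FiniteDimensional ℝ E] {f g : E → ℝ} (hf : Continuous f) (hg : Continuous g)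
    (hf2 : ∀ (s : ℝ) y, f (s • y) = s ^ 2 * f y) (hg2 : ∀ (s : ℝ) y, g (s • y) = s ^ 2 * g y)
    (hpos : ∀ y, y ≠ 0 → 0 < g y) :
    ∃ C, 0 < C ∧ ∀ y, f y ≤ C * g y := by
  have : ProperSpace E := FiniteDimensional.proper_real E
  have hcomp : IsCompact (Metric.sphere (0 : E) 1) := isCompact_sphere 0 1
  have hne : ∀ y ∈ Metric.sphere (0 : E) 1, g y ≠ 0 := fun y hy =>
    (hpos y (by rintro rfl; simp at hy)).ne'
  obtain ⟨C, hC⟩ := hcomp.bddAbove_image (f := fun y => f y / g y)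
    (hf.continuousOn.div hg.continuousOn hne)
  refine ⟨max C 1, by positivity, fun y => ?_⟩
  rcases eq_or_ne y 0 with rfl | hy
  · have h1 := hf2 0 0
    have h2 := hg2 0 0
    simp only [smul_zero] at h1 h2
    rw [h1, h2]; simp
  · have hn : ‖y‖ ≠ 0 := norm_ne_zero_iff.2 hy
    have hu : ‖y‖⁻¹ • y ∈ Metric.sphere (0 : E) 1 := by simp [norm_smul, hn]
    have h1 := hC ⟨_, hu, rfl⟩
    simp only [hf2, hg2] at h1
    rw [mul_div_mul_left _ _ (by positivity), div_le_iff₀ (hpos y hy)] at h1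
    exact h1.trans (mul_le_mul_of_nonneg_right (le_max_left _ _) (hpos y hy).le)

/-- Recursive averages of a null sequence with stepsizes `βₖ → 0`, `∑ βₖ = ∞` tend to `0`. -/
theorem tendsto_zero_of_averaging {β b ε : ℕ → ℝ} (hβ0 : ∀ k, 0 ≤ β k)
    (hβ : Tendsto β atTop (𝓝 0)) (hdiv : ¬ Summable β)
    (hb : ∀ k, b (k + 1) = (1 - β k) * b k + β k * ε k) (hε : Tendsto ε atTop (𝓝 0)) :
    Tendsto b atTop (𝓝 0) := by
  rw [Metric.tendsto_atTop]
  intro δ hδ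
  obtain ⟨N, hN⟩ : ∃ N, ∀ k ≥ N, β k ≤ 1 ∧ |ε k| ≤ δ / 2 := by
    have h1 : ∀ᶠ k in atTop, β k ≤ 1 := hβ.eventually (ge_mem_nhds zero_lt_one)
    have h2 : ∀ᶠ k in atTop, |ε k| ≤ δ / 2 :=
      (by simpa using hε.abs : Tendsto (fun k => |ε k|) atTop (𝓝 0)).eventually
        (ge_mem_nhds (by linarith))
    exact eventually_atTop.1 (h1.and h2)
  have hbound : ∀ n, |b (N + n)| - δ / 2 ≤
      |b N| * Real.exp (-∑ j ∈ Finset.range n, β (N + j)) := by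
    intro n
    induction n with
    | zero => simp only [add_zero, Finset.range_zero, Finset.sum_empty, neg_zero, Real.exp_zero]
              linarith
    | succ n ih =>
      obtain ⟨h1, h2⟩ := hN (N + n) (by omega)
      have h3 : |b (N + (n + 1))| ≤ (1 - β (N + n)) * |b (N + n)| + β (N + n) * (δ / 2) := by
        rw [← add_assoc, hb]
        refine (abs_add_le _ _).trans ?_
        rw [abs_mul, abs_mul, abs_of_nonneg (sub_nonneg.2 h1), abs_of_nonneg (hβ0 _)]
        gcongr
        exact hβ0 _
      have h4 : |b (N + (n + 1))| - δ / 2 ≤ (1 - β (N + n)) * (|b (N + n)| - δ / 2) := by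
        linarith
      have h5 : 1 - β (N + n) ≤ Real.exp (-β (N + n)) := Real.one_sub_le_exp_neg _
      rw [Finset.sum_range_succ, neg_add, Real.exp_add]
      calc _ ≤ _ := h4
        _ ≤ (1 - β (N + n)) * (|b N| * Real.exp (-∑ j ∈ Finset.range n, β (N + j))) :=
          mul_le_mul_of_nonneg_left ih (sub_nonneg.2 h1)
        _ ≤ Real.exp (-β (N + n)) * (|b N| * Real.exp (-∑ j ∈ Finset.range n, β (N + j))) := by
          gcongr
        _ = _ := by ring
  have hdiv' : Tendsto (fun n => ∑ j ∈ Finset.range n, β (N + j)) atTop atTop := by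
    refine (not_summable_iff_tendsto_nat_atTop_of_nonneg fun j => hβ0 _).1 fun h => hdiv ?_
    refine (summable_nat_add_iff N).1 (h.congr fun j => ?_)
    rw [add_comm]
  have hlim : Tendsto (fun n => |b N| * Real.exp (-∑ j ∈ Finset.range n, β (N + j))) atTop
      (𝓝 0) := by
    simpa using (Real.tendsto_exp_neg_atTop_nhds_zero.comp hdiv').const_mul |b N|
  obtain ⟨n₀, hn₀⟩ := eventually_atTop.1 (hlim.eventually (gt_mem_nhds (half_pos hδ)))
  refine ⟨N + n₀, fun k hk => ?_⟩
  obtain ⟨n, rfl⟩ := Nat.exists_eq_add_of_le (show N ≤ k by omega)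
  have h1 := hbound n
  have h2 := hn₀ n (by omega)
  rw [Real.dist_eq, sub_zero]
  linarith

theorem DiffGQ.IsStepsize.tendsto_zero {α : ℕ → ℝ} (hα : IsStepsize α) : Tendsto α atTop (𝓝 0) := by
  have h := hα.summable_sq.tendsto_atTop_zero.sqrt
  simpa [Real.sqrt_sq, (hα.pos _).le] using h

section LinearRecursion

variable {E : Type*} [NormedAddCommGroup E] [NormedSpace ℝ E] [FiniteDimensional ℝ E]

/-- Bilinear forms on a finite-dimensional space are jointly continuous. -/
theorem continuous_bilin_apply {F : Type*} [TopologicalSpace F] (Q : LinearMap.BilinForm ℝ E)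
    {f g : F → E} (hf : Continuous f) (hg : Continuous g) : Continuous fun y => Q (f y) (g y) := by
  have h : Continuous fun q : E × E => Q q.1 q.2 := by
    let b := Module.finBasis ℝ E
    have : (fun q : E × E => Q q.1 q.2) =
        fun q => ∑ i, ∑ j, b.repr q.1 i * (b.repr q.2 j * Q (b i) (b j)) := by
      funext q
      conv_lhs => rw [← b.sum_repr q.1, ← b.sum_repr q.2]
      simp only [map_sum, LinearMap.sum_apply, map_smul, LinearMap.smul_apply, smul_eq_mul,
        Finset.mul_sum]
      rw [Finset.sum_comm]
      simp only [mul_left_comm]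
    rw [this]
    have hc : ∀ i, Continuous fun y : E => b.repr y i := fun i =>
      (b.coord i).continuous_of_finiteDimensional
    refine continuous_finsetSum _ fun i _ => continuous_finsetSum _ fun j _ => ?_
    exact ((hc i).comp continuous_fst).mul (((hc j).comp continuous_snd).mul continuous_const)
  exact h.comp (hf.prodMk hg)

variable {Ω T : Type*} {m0 : MeasurableSpace Ω} {μ : Measure Ω} [Fintype T]
  [MeasurableSpace T] [MeasurableSingletonClass T] {ℱ : Filtration ℕ m0} {z : ℕ → Ω → T}

/-- Almost sure convergence of linear stochastic approximation: the recursion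
`y (k + 1) = y k + αₖ (L (z k) (y k) + g (z k))` with i.i.d. samples, centred noise `g` and a mean
matrix that decreases some inner product `Q` tends to `0`. -/
theorem ae_tendsto_zero_of_linear [IsProbabilityMeasure μ]
    (hz : ∀ k, Measurable[ℱ (k + 1)] (z k))
    (hindep : ∀ k, Indep (MeasurableSpace.comap (z k) inferInstance) (ℱ k) μ)
    {p : T → ℝ} (hp : ∀ k t, μ.real (z k ⁻¹' {t}) = p t) (hp0 : ∀ t, 0 ≤ p t)
    (hp1 : ∑ t, p t = 1)
    {α : ℕ → ℝ} (hα : IsStepsize α) (L : T → E →ₗ[ℝ] E) (g : T → E)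
    (hg : ∑ t, p t • g t = 0) (Q : LinearMap.BilinForm ℝ E) (hsymm : ∀ u v, Q u v = Q v u)
    (hQ : ∀ y, y ≠ 0 → 0 < Q y y) (hdrift : ∀ y, y ≠ 0 → Q y (∑ t, p t • L t y) < 0) (y₀ : E) :
    ∀ᵐ ω ∂μ, Tendsto (randomRec (fun k t y => y + α k • (L t y + g t)) y₀ fun j => z j ω)
      atTop (𝓝 0) := by
  have hL : ∀ t, Continuous (L t) := fun t => (L t).continuous_of_finiteDimensional
  have hVc : Continuous fun y => Q y y := continuous_bilin_apply Q continuous_id continuous_id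
  have hV2 : ∀ (s : ℝ) y, Q (s • y) (s • y) = s ^ 2 * Q y y := fun s y => by
    simp [pow_two, mul_assoc]
  have hV0 : ∀ y, 0 ≤ Q y y := fun y => by
    rcases eq_or_ne y 0 with rfl | h
    · simp
    · exact (hQ y h).le
  -- the drift dominates `Q`, and `Q` dominates the second moment of the increments
  obtain ⟨c, hc, hcle⟩ := exists_le_mul_of_homogeneous (f := fun y => Q y y)
    (g := fun y => -Q y (∑ t, p t • L t y)) hVc
    (continuous_bilin_apply Q continuous_id (by fun_prop)).neg hV2
    (fun s y => by
      simp only [map_smul, smul_comm _ s, ← Finset.smul_sum, LinearMap.smul_apply, smul_eq_mul]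
      ring)
    (fun y hy => neg_pos.2 (hdrift y hy))
  obtain ⟨C, hC, hCle⟩ := exists_le_mul_of_homogeneous (f := fun y => ∑ t, p t * Q (L t y) (L t y))
    (g := fun y => Q y y)
    (continuous_finsetSum _ fun t _ => continuous_const.mul
      (continuous_bilin_apply Q (hL t) (hL t))) hVc
    (fun s y => by
      simp only [map_smul, Finset.mul_sum, LinearMap.smul_apply, smul_eq_mul]
      exact Finset.sum_congr rfl fun t _ => by ring)
    hV2 hQ
  set B := ∑ t, p t * Q (g t) (g t) with hB
  have hB0 : 0 ≤ B := Finset.sum_nonneg fun t _ => mul_nonneg (hp0 t) (hV0 _)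
  have hpar : ∀ u v, Q (u + v) (u + v) ≤ 2 * Q u u + 2 * Q v v := fun u v => by
    have := hV0 (u - v)
    simp only [map_sub, map_add, LinearMap.sub_apply, LinearMap.add_apply] at this ⊢
    linarith
  have hlyap := ae_tendsto_zero_of_lyapunov (fun k t y => y + α k • (L t y + g t)) y₀ hz hindep hp
    (V := fun y => Q y y) hV0 hα (c := 2 / c) (C := 2 * C + 2 * B) (by positivity) (by positivity)
    (fun k y => by
      have hα0 := (hα.pos k).le
      have hexp : ∀ t, Q (y + α k • (L t y + g t)) (y + α k • (L t y + g t)) ≤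
          Q y y + 2 * α k * (Q y (L t y) + Q y (g t)) +
            α k ^ 2 * (2 * Q (L t y) (L t y) + 2 * Q (g t) (g t)) := fun t => by
        have h1 := mul_le_mul_of_nonneg_left (hpar (L t y) (g t)) (sq_nonneg (α k))
        have h2 : Q (y + α k • (L t y + g t)) (y + α k • (L t y + g t)) =
            Q y y + 2 * α k * (Q y (L t y) + Q y (g t)) +
              α k ^ 2 * Q (L t y + g t) (L t y + g t) := by
          simp only [map_add, map_smul, LinearMap.add_apply, LinearMap.smul_apply, smul_eq_mul,
            hsymm (L t y) y, hsymm (g t) y]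
          ring
        linarith
      have hmean : ∑ t, p t * (Q y (L t y) + Q y (g t)) = Q y (∑ t, p t • L t y) := by
        have h1 : Q y (∑ t, p t • g t) = 0 := by rw [hg, map_zero]
        rw [map_sum] at h1 ⊢
        simp only [map_smul, smul_eq_mul] at h1 ⊢
        simp only [mul_add, Finset.sum_add_distrib, h1, add_zero]
      calc ∑ t, p t * Q (y + α k • (L t y + g t)) (y + α k • (L t y + g t))
          ≤ ∑ t, p t * (Q y y + 2 * α k * (Q y (L t y) + Q y (g t)) +
            α k ^ 2 * (2 * Q (L t y) (L t y) + 2 * Q (g t) (g t))) :=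
            Finset.sum_le_sum fun t _ => mul_le_mul_of_nonneg_left (hexp t) (hp0 t)
        _ = (∑ t, p t) * Q y y + 2 * α k * ∑ t, p t * (Q y (L t y) + Q y (g t)) +
            α k ^ 2 * (2 * ∑ t, p t * Q (L t y) (L t y) + 2 * B) := by
            simp only [hB, Finset.sum_mul, Finset.mul_sum, ← Finset.sum_add_distrib]
            exact Finset.sum_congr rfl fun t _ => by ring
        _ ≤ Q y y - 2 * α k * (Q y y / c) + α k ^ 2 * (2 * (C * Q y y) + 2 * B) := by
            rw [hmean, hp1, one_mul]
            have h1 : Q y y / c ≤ -Q y (∑ t, p t • L t y) := by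
              rw [div_le_iff₀ hc, mul_comm]; exact hcle y
            have h2 := mul_le_mul_of_nonneg_left h1 hα0
            have h3 := mul_le_mul_of_nonneg_left (hCle y) (sq_nonneg (α k))
            linarith
        _ ≤ (1 - 2 / c * α k + (2 * C + 2 * B) * α k ^ 2) * Q y y +
            (2 * C + 2 * B) * α k ^ 2 := by
            have h1 : 0 ≤ B * α k ^ 2 * Q y y := by
              have := hV0 y; positivity
            have h2 : 0 ≤ C * α k ^ 2 := by positivity
            have h3 : 2 * α k * (Q y y / c) = 2 / c * α k * Q y y := by ring
            linarith)
  -- `Q` dominates the square of the norm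
  obtain ⟨C', hC', hC'le⟩ := exists_le_mul_of_homogeneous (f := fun y : E => ‖y‖ ^ 2)
    (g := fun y => Q y y) (by fun_prop) hVc (fun s y => by simp [norm_smul, mul_pow]) hV2 hQ
  filter_upwards [hlyap] with ω hω
  rw [tendsto_zero_iff_norm_tendsto_zero]
  have h1 := squeeze_zero (fun k => sq_nonneg _) (fun k => hC'le _)
    (by simpa using hω.const_mul C')
  simpa [Real.sqrt_sq] using h1.sqrt

end LinearRecursion

/-! ### Pseudoinverses and ridge regression -/

section PosDef

variable {n : Type*} [Fintype n]

/-- The operator `(η I + S)⁻¹ S` is a contraction when `S` is positive semidefinite. -/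
theorem dotProduct_self_le_of_ridge {S : Matrix n n ℝ} (hS : S.PosSemidef) {η : ℝ} (hη : 0 < η)
    {u m : n → ℝ} (h : η • u + S *ᵥ u = S *ᵥ m) : u ⬝ᵥ u ≤ m ⬝ᵥ m := by
  have h1 : η • u = -(S *ᵥ (u - m)) := by
    rw [Matrix.mulVec_sub, ← h]; abel
  have h2 : 0 ≤ (u - m) ⬝ᵥ S *ᵥ (u - m) := by simpa using hS.dotProduct_mulVec_nonneg (u - m)
  have h3 : η * ((u - m) ⬝ᵥ u) = -((u - m) ⬝ᵥ S *ᵥ (u - m)) := by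
    rw [← smul_eq_mul, ← dotProduct_smul, h1, dotProduct_neg]
  have h4 : (u - m) ⬝ᵥ u ≤ 0 := by
    by_contra! hc
    have := mul_pos hη hc
    linarith
  have h5 : 0 ≤ (u - m) ⬝ᵥ (u - m) := by simpa using dotProduct_star_self_nonneg (u - m)
  simp only [sub_dotProduct, dotProduct_sub, dotProduct_comm m u] at h4 h5
  linarith

variable [DecidableEq n]

theorem Matrix.PosDef.exists_posDef_sqrt {C : Matrix n n ℝ} (hC : C.PosDef) :
    ∃ H : Matrix n n ℝ, H.PosDef ∧ H * H = C := by
  open scoped MatrixOrder in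
  refine ⟨CFC.sqrt C, ?_, CFC.sqrt_mul_sqrt_self C hC.posSemidef.nonneg⟩
  refine ((CFC.sqrt_nonneg C).posSemidef.posDef_iff_isUnit).2 ?_
  have h := CFC.sqrt_mul_sqrt_self C hC.posSemidef.nonneg
  refine isUnit_of_mul_isUnit_left (y := CFC.sqrt C) ?_
  rw [h]
  exact hC.isUnit

/-- A real symmetric matrix has a symmetric generalized inverse commuting with it. -/
theorem exists_symmetric_pinv {S : Matrix n n ℝ} (hS : S.IsHermitian) :
    ∃ R : Matrix n n ℝ, Rᵀ = R ∧ S * R * S = S ∧ R * S * R = R ∧ S * R = R * S := by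
  let U : Matrix n n ℝ := hS.eigenvectorUnitary
  let l : n → ℝ := hS.eigenvalues
  have hU : Uᵀ * U = 1 := by
    have := Unitary.coe_star_mul_self hS.eigenvectorUnitary
    simpa [U, star_eq_conjTranspose] using this
  have hSU : S = U * diagonal l * Uᵀ := by
    conv_lhs => rw [hS.spectral_theorem]
    simp [U, l, Unitary.conjStarAlgAut_apply, star_eq_conjTranspose]
  have hprod : ∀ a b : n → ℝ, (U * diagonal a * Uᵀ) * (U * diagonal b * Uᵀ) =
      U * diagonal (fun i => a i * b i) * Uᵀ := fun a b => by
    calc _ = U * diagonal a * (Uᵀ * U) * diagonal b * Uᵀ := by simp only [Matrix.mul_assoc]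
      _ = _ := by rw [hU, Matrix.mul_one, Matrix.mul_assoc U, diagonal_mul_diagonal]
  -- the convention `0⁻¹ = 0` is exactly what the kernel of `S` needs
  refine ⟨U * diagonal (fun i => (l i)⁻¹) * Uᵀ, ?_, ?_, ?_, ?_⟩
  · simp [Matrix.transpose_mul, Matrix.mul_assoc]
  · rw [hSU, hprod, hprod]
    simp only [mul_inv_mul_cancel]
  · rw [hSU, hprod, hprod]
    simpa using congrArg (fun a => U * diagonal a * Uᵀ)
      (funext fun i => mul_inv_mul_cancel ((l i)⁻¹))
  · rw [hSU, hprod, hprod]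
    simp only [mul_comm]

/-- If `R` is the symmetric generalized inverse of `BᵀB`, then `R Bᵀ` is the pseudoinverse
of `B`. -/
theorem exists_isMoorePenrose (B : Matrix n n ℝ) : ∃ N, IsMoorePenrose B N := by
  have hS : (Bᵀ * B).IsHermitian := by
    simpa using isHermitian_conjTranspose_mul_self B
  obtain ⟨R, hRt, h1, h2, h3⟩ := exists_symmetric_pinv hS
  have h4 : B * R * Bᵀ * B = B := by
    have hz : (B * R * Bᵀ * B - B)ᴴ * (B * R * Bᵀ * B - B) = 0 := by
      rw [conjTranspose_eq_transpose_of_trivial]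
      have e1 : (B * R * Bᵀ * B - B)ᵀ = (Bᵀ * B * R - 1) * Bᵀ := by
        simp [Matrix.transpose_mul, hRt, Matrix.mul_assoc, Matrix.sub_mul]
      have e2 : Bᵀ * (B * R * Bᵀ * B - B) = 0 := by
        rw [Matrix.mul_sub, sub_eq_zero]
        simpa only [Matrix.mul_assoc] using h1
      rw [e1, Matrix.mul_assoc, e2, Matrix.mul_zero]
    exact sub_eq_zero.1 (conjTranspose_mul_self_eq_zero.1 hz)
  refine ⟨R * Bᵀ, ?_, ?_, ?_, ?_⟩
  · simpa only [Matrix.mul_assoc] using h4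
  · calc R * Bᵀ * B * (R * Bᵀ) = R * (Bᵀ * B) * R * Bᵀ := by simp only [Matrix.mul_assoc]
      _ = _ := by rw [h2]
  · simp [Matrix.transpose_mul, hRt, Matrix.mul_assoc]
  · calc (R * Bᵀ * B)ᵀ = Bᵀ * B * R := by simp [Matrix.transpose_mul, hRt, Matrix.mul_assoc]
      _ = R * Bᵀ * B := by rw [h3]; simp only [Matrix.mul_assoc]

end PosDef

section Ridge

variable {K : ℕ}

theorem l2norm_sq (v : Fin K → ℝ) : l2norm v ^ 2 = v ⬝ᵥ v := by
  rw [l2norm, EuclideanSpace.real_norm_sq_eq]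
  simp [dotProduct, pow_two]

theorem l2norm_le_of_dotProduct_le {u v : Fin K → ℝ} (h : u ⬝ᵥ u ≤ v ⬝ᵥ v) :
    l2norm u ≤ l2norm v :=
  (sq_le_sq₀ (norm_nonneg _) (norm_nonneg _)).1 (by
    change l2norm u ^ 2 ≤ l2norm v ^ 2
    rwa [l2norm_sq, l2norm_sq])

/-- Ridge regression is within distance `O(η)` of the Moore–Penrose solution: the difference is
`-η (η I + BᵀB)⁻¹ N h`, and `N = BᵀB (N Nᵀ N)`, so `(η I + BᵀB)⁻¹ N h` stays bounded. -/
theorem l2norm_ridge_sub_le {B N : Matrix (Fin K) (Fin K) ℝ} (hN : IsMoorePenrose B N)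
    {η : ℝ} (hη : 0 < η) (h : Fin K → ℝ) :
    l2norm ((η • (1 : Matrix (Fin K) (Fin K) ℝ) + Bᵀ * B)⁻¹ *ᵥ (Bᵀ *ᵥ h) - N *ᵥ h) ≤
      η * l2norm ((N * Nᵀ * N) *ᵥ h) := by
  have hS : (Bᵀ * B).PosSemidef := by simpa using posSemidef_conjTranspose_mul_self B
  have hu : IsUnit (η • (1 : Matrix (Fin K) (Fin K) ℝ) + Bᵀ * B).det :=
    (isUnit_iff_isUnit_det _).1 ((PosDef.one.smul hη).add_posSemidef hS).isUnit
  set W := (η • (1 : Matrix (Fin K) (Fin K) ℝ) + Bᵀ * B)⁻¹ with hW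
  have hBN : Bᵀ * B * N = Bᵀ := by
    rw [Matrix.mul_assoc, ← hN.symm_left, ← Matrix.transpose_mul, hN.mul_mul_left]
  have hSM : Bᵀ * B * (N * Nᵀ * N) = N := by
    calc Bᵀ * B * (N * Nᵀ * N) = Bᵀ * B * N * Nᵀ * N := by simp only [Matrix.mul_assoc]
      _ = (N * B)ᵀ * N := by rw [hBN, Matrix.transpose_mul]
      _ = N := by rw [hN.symm_right, hN.mul_mul_right]
  set u := W *ᵥ (N *ᵥ h) with hudef
  have hWu : (η • (1 : Matrix (Fin K) (Fin K) ℝ) + Bᵀ * B) *ᵥ u = N *ᵥ h := by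
    rw [hudef, Matrix.mulVec_mulVec, hW, Matrix.mul_nonsing_inv _ hu, Matrix.one_mulVec]
  have hd : W *ᵥ (Bᵀ *ᵥ h) - N *ᵥ h = -(η • u) := by
    have h1 : Bᵀ *ᵥ h = (η • (1 : Matrix (Fin K) (Fin K) ℝ) + Bᵀ * B) *ᵥ (N *ᵥ h) -
        η • (N *ᵥ h) := by
      rw [Matrix.add_mulVec, Matrix.smul_mulVec, Matrix.one_mulVec, Matrix.mulVec_mulVec, hBN]
      abel
    rw [h1, Matrix.mulVec_sub, Matrix.mulVec_mulVec, hW, Matrix.nonsing_inv_mul _ hu,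
      Matrix.one_mulVec, ← hW, Matrix.mulVec_smul]
    abel
  have hle : l2norm u ≤ l2norm ((N * Nᵀ * N) *ᵥ h) := by
    refine l2norm_le_of_dotProduct_le (dotProduct_self_le_of_ridge hS hη ?_)
    rw [Matrix.mulVec_mulVec h, hSM, ← hWu, Matrix.add_mulVec, Matrix.smul_mulVec,
      Matrix.one_mulVec]
  have hnorm : l2norm (-(η • u)) = η * l2norm u := by
    simp [l2norm, WithLp.toLp_neg, WithLp.toLp_smul, norm_smul, abs_of_pos hη]
  rw [hd, hnorm]
  exact mul_le_mul_of_nonneg_left hle hη.le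

end Ridge

/-! ### Expectations under the sampling distribution -/

section MeanField

variable {S A : Type*} [Fintype S] [Fintype A] {K : ℕ}
  (M : MDP S A) (π : Policy S A) (d : S × A → ℝ) (x : S × A → Fin K → ℝ)

/-- Expectation of a product of a function of `(S, A)` and a function of `(S', A')`. -/
theorem sum_sampleDist_mul (φ ψ : S × A → ℝ) :
    ∑ z, sampleDist M π d z * (φ z.1 * ψ z.2) = ∑ sa, d sa * (φ sa * (saMatrix M π *ᵥ ψ) sa) := by
  rw [Fintype.sum_prod_type]
  refine Finset.sum_congr rfl fun sa _ => ?_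
  simp only [mulVec, dotProduct, saMatrix, of_apply, sampleDist, Finset.mul_sum]
  exact Finset.sum_congr rfl fun sa' _ => by ring

theorem saMatrix_mulVec_one : saMatrix M π *ᵥ (fun _ => 1) = fun _ => 1 := by
  funext sa
  simp only [mulVec, dotProduct, saMatrix, of_apply, mul_one, Fintype.sum_prod_type,
    ← Finset.mul_sum, π.prob_sum, M.p_sum]

theorem sum_sampleDist_fst (φ : S × A → ℝ) :
    ∑ z, sampleDist M π d z * φ z.1 = ∑ sa, d sa * φ sa := by
  have h := sum_sampleDist_mul M π d φ fun _ => 1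
  simpa only [saMatrix_mulVec_one, mul_one] using h

theorem sum_sampleDist (hd : ∑ sa, d sa = 1) : ∑ z, sampleDist M π d z = 1 := by
  have h := sum_sampleDist_fst M π d fun _ => 1
  simpa only [mul_one, hd] using h

/-- The law of a pair of independent samples. -/
def pairDist (t : Sample S A × Sample S A) : ℝ := sampleDist M π d t.1 * sampleDist M π d t.2

theorem sum_pairDist_mul (f g : Sample S A → ℝ) :
    ∑ t, pairDist M π d t * (f t.1 * g t.2) =
      (∑ z, sampleDist M π d z * f z) * ∑ z, sampleDist M π d z * g z := by
  rw [Fintype.sum_prod_type, Finset.sum_mul_sum]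
  refine Finset.sum_congr rfl fun z _ => Finset.sum_congr rfl fun z' _ => ?_
  simp only [pairDist]; ring

theorem pairDist_nonneg (hd : ∀ sa, 0 < d sa) (t : Sample S A × Sample S A) :
    0 ≤ pairDist M π d t := by
  have : ∀ s, 0 ≤ sampleDist M π d s := fun s =>
    mul_nonneg (hd _).le (mul_nonneg (M.p_nonneg _ _) (π.prob_nonneg _ _))
  exact mul_nonneg (this _) (this _)

theorem sum_pairDist (hd : ∑ sa, d sa = 1) : ∑ t, pairDist M π d t = 1 := by
  have h := sum_pairDist_mul M π d (fun _ => 1) fun _ => 1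
  simpa [sum_sampleDist M π d hd] using h

theorem sum_sampleDist_tdTerm (φ : S × A → ℝ) (w : Fin K → ℝ) :
    ∑ z, sampleDist M π d z * (φ z.1 * tdTerm M x z w) =
      ∑ sa, d sa * (φ sa * rbar M π x w sa) := by
  have h1 := sum_sampleDist_fst M π d fun sa => φ sa * M.r sa
  have h2 := sum_sampleDist_mul M π d φ (featureMatrix x *ᵥ w)
  have h3 := sum_sampleDist_fst M π d fun sa => φ sa * (featureMatrix x *ᵥ w) sa
  calc _ = ∑ z, sampleDist M π d z * (φ z.1 * M.r z.1) +
        ∑ z, sampleDist M π d z * (φ z.1 * (featureMatrix x *ᵥ w) z.2) -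
        ∑ z, sampleDist M π d z * (φ z.1 * (featureMatrix x *ᵥ w) z.1) := by
        rw [← Finset.sum_add_distrib, ← Finset.sum_sub_distrib]
        refine Finset.sum_congr rfl fun z _ => ?_
        simp only [tdTerm, mulVec, featureMatrix, of_apply]
        ring
    _ = _ := by
        rw [h1, h2, h3, ← Finset.sum_add_distrib, ← Finset.sum_sub_distrib]
        refine Finset.sum_congr rfl fun z _ => ?_
        simp only [rbar, Pi.add_apply, Pi.sub_apply]
        ring

theorem sum_sampleDist_tdTerm_one (w : Fin K → ℝ) :
    ∑ z, sampleDist M π d z * tdTerm M x z w = rateOf M π d x w := by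
  have h := sum_sampleDist_tdTerm M π d x (fun _ => 1) w
  simp only [one_mul] at h
  exact h

variable [DecidableEq S] [DecidableEq A]

theorem A₂_mulVec_add_b₂ (w : Fin K → ℝ) :
    A₂ M π d x *ᵥ w + b₂ M d x = (featureMatrix x)ᵀ *ᵥ
      (diagonal d *ᵥ (rbar M π x w - fun _ => d ⬝ᵥ rbar M π x w)) := by
  have h : A₂ M π d x *ᵥ w + b₂ M d x =
      ((featureMatrix x)ᵀ * (diagonal d - vecMulVec d d)) *ᵥ rbar M π x w := by
    simp only [A₂, b₂, rbar, ← mulVec_mulVec, mulVec_add, mulVec_sub, sub_mulVec, one_mulVec]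
    abel
  rw [h, ← mulVec_mulVec]
  congr 1
  funext sa
  simp [sub_mulVec, vecMulVec_mulVec, mulVec_diagonal, mul_sub, mul_comm]

theorem A₂_mulVec_add_b₂_apply (w : Fin K → ℝ) (i : Fin K) :
    (A₂ M π d x *ᵥ w + b₂ M d x) i =
      ∑ sa, d sa * (x sa i * (rbar M π x w sa - rateOf M π d x w)) := by
  rw [A₂_mulVec_add_b₂]
  simp only [mulVec, dotProduct, transpose_apply, featureMatrix, of_apply, rateOf]
  refine Finset.sum_congr rfl fun sa _ => ?_
  simp [diagonal_apply]
  ring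

theorem C₂_mulVec_apply (v : Fin K → ℝ) (i : Fin K) :
    (C₂ d x *ᵥ v) i = ∑ sa, d sa * (x sa i * (x sa ⬝ᵥ v)) := by
  simp only [C₂, ← mulVec_mulVec]
  simp only [mulVec, dotProduct, transpose_apply, featureMatrix, of_apply]
  refine Finset.sum_congr rfl fun sa _ => ?_
  simp [diagonal_apply]
  ring

theorem C₂_posDef (hd : ∀ sa, 0 < d sa)
    (hX : LinearIndependent ℝ (fun j : Fin K => fun sa => featureMatrix x sa j)) :
    (C₂ d x).PosDef := by
  have hinj : Function.Injective (featureMatrix x).mulVec := by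
    rw [mulVec_injective_iff]
    exact hX
  have := (PosDef.diagonal hd).conjTranspose_mul_mul_same hinj
  simpa [C₂] using this

/-- The condition `𝔼[δ] = 0` fixes the reward rate; eliminating it from `𝔼[δ x] = 0` leaves
`A₂ w + b₂ = 0`. -/
theorem isTDFixedPoint_iff (hd : ∑ sa, d sa = 1) (rhat : ℝ) (w : Fin K → ℝ) :
    IsTDFixedPoint M π d x rhat w ↔
      rhat = rateOf M π d x w ∧ A₂ M π d x *ᵥ w + b₂ M d x = 0 := by
  have h1 : ∑ z : Sample S A, sampleDist M π d z * (tdTerm M x z w - rhat) =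
      rateOf M π d x w - rhat := by
    simp only [mul_sub, Finset.sum_sub_distrib, sum_sampleDist_tdTerm_one, ← Finset.sum_mul,
      sum_sampleDist M π d hd, one_mul]
  have h2 : ∀ i, (∑ z : Sample S A, (sampleDist M π d z * (tdTerm M x z w - rhat)) • x z.1) i =
      ∑ sa, d sa * (x sa i * (rbar M π x w sa - rhat)) := fun i => by
    have e1 := sum_sampleDist_tdTerm M π d x (fun sa => x sa i) w
    have e2 := sum_sampleDist_fst M π d fun sa => x sa i * rhat
    simp only [Finset.sum_apply, Pi.smul_apply, smul_eq_mul, mul_sub, Finset.sum_sub_distrib]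
    rw [← e1, ← e2, ← Finset.sum_sub_distrib]
    exact Finset.sum_congr rfl fun z _ => by ring
  rw [IsTDFixedPoint, h1, sub_eq_zero, and_comm, eq_comm]
  refine and_congr_right fun hr => ?_
  rw [funext_iff, funext_iff]
  refine forall_congr' fun i => ?_
  rw [h2, A₂_mulVec_add_b₂_apply, hr]

end MeanField

/-! ### The update as a random affine map and its mean field -/

section Increments

variable {S A : Type*} [Fintype S] {K : ℕ} (M : MDP S A) (x : S × A → Fin K → ℝ)

/-- The increment of `(ν, w)` in one step of Diff-GQ2, divided by the stepsize. -/
def gq2Drift (η : ℝ) (t : Sample S A × Sample S A) (y : (Fin K → ℝ) × (Fin K → ℝ)) :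
    (Fin K → ℝ) × (Fin K → ℝ) :=
  ((tdTerm M x t.1 y.2 - tdTerm M x t.2 y.2 - x t.1.1 ⬝ᵥ y.1) • x t.1.1,
    (x t.1.1 ⬝ᵥ y.1) • ((x t.1.1 - x t.1.2) - (x t.2.1 - x t.2.2)) - η • y.2)

/-- The linear part of `gq2Drift`. -/
def gq2Linear (η : ℝ) (t : Sample S A × Sample S A) :
    (Fin K → ℝ) × (Fin K → ℝ) →ₗ[ℝ] (Fin K → ℝ) × (Fin K → ℝ) where
  toFun y := (((x t.1.2 - x t.1.1 - (x t.2.2 - x t.2.1)) ⬝ᵥ y.2 - x t.1.1 ⬝ᵥ y.1) • x t.1.1,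
    (x t.1.1 ⬝ᵥ y.1) • ((x t.1.1 - x t.1.2) - (x t.2.1 - x t.2.2)) - η • y.2)
  map_add' y y' := by
    ext i <;> simp [dotProduct_add] <;> ring
  map_smul' a y := by
    ext i <;> simp [dotProduct_smul] <;> ring

theorem gq2Drift_add (η : ℝ) (t : Sample S A × Sample S A) (y u : (Fin K → ℝ) × (Fin K → ℝ)) :
    gq2Drift M x η t (y + u) = gq2Linear x η t u + gq2Drift M x η t y := by
  ext i <;> simp [gq2Drift, gq2Linear, tdTerm, dotProduct_add, sub_dotProduct] <;> ring

/-- Recentred at an arbitrary point `y`, the pairs `(νₖ, wₖ)` follow a linear recursion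
whose noise is the drift at `y`. -/
theorem gq2Iter_eq_randomRec {α β : ℕ → ℝ} (η : ℝ) (y : (Fin K → ℝ) × (Fin K → ℝ))
    (init : Iterate K) (s : ℕ → Fin 2 → Sample S A) (k : ℕ) :
    ((gq2Iter M x η α β s init k).ν, (gq2Iter M x η α β s init k).w) =
      y + randomRec (fun k t u => u + α k • (gq2Linear x η t u + gq2Drift M x η t y))
        ((init.ν, init.w) - y) (fun j => (s j 0, s j 1)) k := by
  induction k with
  | zero => simp [gq2Iter, randomRec]
  | succ k ih =>
    rw [randomRec, ← gq2Drift_add, ← add_assoc, ← ih]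
    ext i
    · simp [gq2Iter, gq2Step, gq2Drift]; ring
    · simp [gq2Iter, gq2Step, gq2Drift]; ring

end Increments

section Updates

variable {S A : Type*} [Fintype S] [Fintype A] [DecidableEq S] [DecidableEq A] {K : ℕ}
  (M : MDP S A) (π : Policy S A) (d : S × A → ℝ) (x : S × A → Fin K → ℝ)

/-- The coordinates of `A₂ᵀ v` as a covariance of the feature differences with `xᵀ v`. -/
theorem A₂_transpose_mulVec_apply (v : Fin K → ℝ) (i : Fin K) :
    ((A₂ M π d x)ᵀ *ᵥ v) i =
      (∑ z, sampleDist M π d z * ((x z.2 i - x z.1 i) * (x z.1 ⬝ᵥ v))) -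
      (∑ z, sampleDist M π d z * (x z.1 ⬝ᵥ v)) *
        ∑ z, sampleDist M π d z * (x z.2 i - x z.1 i) := by
  have h0 : (A₂ M π d x)ᵀ *ᵥ v = (featureMatrix x)ᵀ *ᵥ ((saMatrix M π - 1)ᵀ *ᵥ
      ((diagonal d - vecMulVec d d) *ᵥ (featureMatrix x *ᵥ v))) := by
    simp only [A₂, transpose_mul, transpose_sub, diagonal_transpose, transpose_vecMulVec,
      mulVec_mulVec, Matrix.mul_assoc, transpose_transpose]
  have h1 : ∀ u : S × A → ℝ, ((featureMatrix x)ᵀ *ᵥ ((saMatrix M π - 1)ᵀ *ᵥ u)) i =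
      ∑ sa, u sa * ((saMatrix M π *ᵥ fun sa => x sa i) sa - x sa i) := fun u => by
    have : ((featureMatrix x)ᵀ *ᵥ ((saMatrix M π - 1)ᵀ *ᵥ u)) i =
        (fun sa => x sa i) ⬝ᵥ ((saMatrix M π - 1)ᵀ *ᵥ u) := rfl
    rw [this, mulVec_transpose, dotProduct_comm, ← dotProduct_mulVec, sub_mulVec, one_mulVec]
    rfl
  have h2 : ∀ φ : S × A → ℝ, ∑ z, sampleDist M π d z * ((x z.2 i - x z.1 i) * φ z.1) =
      ∑ sa, d sa * (φ sa * ((saMatrix M π *ᵥ fun sa => x sa i) sa - x sa i)) := fun φ => by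
    have e1 := sum_sampleDist_mul M π d φ fun sa => x sa i
    have e2 := sum_sampleDist_fst M π d fun sa => φ sa * x sa i
    simp only [mul_sub, Finset.sum_sub_distrib]
    rw [← e1, ← e2, ← Finset.sum_sub_distrib]
    exact Finset.sum_congr rfl fun z _ => by ring
  have h3 := h2 fun _ => 1
  simp only [mul_one, one_mul] at h3
  rw [h0, h1, h2 fun sa => x sa ⬝ᵥ v, h3, sum_sampleDist_fst M π d fun sa => x sa ⬝ᵥ v,
    Finset.mul_sum, ← Finset.sum_sub_distrib]
  refine Finset.sum_congr rfl fun sa _ => ?_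
  simp only [sub_mulVec, vecMulVec_mulVec, mulVec_diagonal, Pi.sub_apply]
  have h4 : ∀ sa, (featureMatrix x *ᵥ v) sa = x sa ⬝ᵥ v := fun _ => rfl
  simp only [dotProduct, h4, Pi.smul_apply, MulOpposite.smul_eq_mul_unop, MulOpposite.unop_op]
  ring

/-- The mean field of Diff-GQ2. -/
theorem sum_pairDist_gq2Drift (hd : ∑ sa, d sa = 1) (η : ℝ) (y : (Fin K → ℝ) × (Fin K → ℝ)) :
    ∑ t, pairDist M π d t • gq2Drift M x η t y =
      (A₂ M π d x *ᵥ y.2 + b₂ M d x - C₂ d x *ᵥ y.1, -((A₂ M π d x)ᵀ *ᵥ y.1) - η • y.2) := by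
  have h1 := sum_sampleDist M π d hd
  have hone : ∑ z, sampleDist M π d z * (1 : ℝ) = 1 := by simpa using h1
  refine Prod.ext (funext fun i => ?_) (funext fun i => ?_)
  · have e1 := sum_pairDist_mul M π d (fun z => x z.1 i * tdTerm M x z y.2) fun _ => 1
    have e2 := sum_pairDist_mul M π d (fun z => x z.1 i) fun z => tdTerm M x z y.2
    have e3 := sum_pairDist_mul M π d (fun z => x z.1 i * (x z.1 ⬝ᵥ y.1)) fun _ => 1
    rw [hone, mul_one] at e1 e3
    rw [sum_sampleDist_tdTerm M π d x fun sa => x sa i] at e1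
    rw [sum_sampleDist_tdTerm_one, sum_sampleDist_fst M π d fun sa => x sa i] at e2
    rw [sum_sampleDist_fst M π d fun sa => x sa i * (x sa ⬝ᵥ y.1)] at e3
    calc _ = ∑ t, pairDist M π d t * (x t.1.1 i * tdTerm M x t.1 y.2 * 1) -
          ∑ t, pairDist M π d t * (x t.1.1 i * tdTerm M x t.2 y.2) -
          ∑ t, pairDist M π d t * (x t.1.1 i * (x t.1.1 ⬝ᵥ y.1) * 1) := by
          simp only [Prod.fst_sum, Finset.sum_apply, Prod.smul_fst, gq2Drift, Pi.smul_apply,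
            smul_eq_mul, ← Finset.sum_sub_distrib]
          exact Finset.sum_congr rfl fun z _ => by ring
      _ = _ := by
          rw [e1, e2, e3]
          change _ = (A₂ M π d x *ᵥ y.2 + b₂ M d x) i - (C₂ d x *ᵥ y.1) i
          rw [A₂_mulVec_add_b₂_apply, C₂_mulVec_apply, Finset.sum_mul,
            ← Finset.sum_sub_distrib]
          congr 1
          exact Finset.sum_congr rfl fun z _ => by ring
  · have e1 := sum_pairDist_mul M π d (fun z => (x z.2 i - x z.1 i) * (x z.1 ⬝ᵥ y.1)) fun _ => 1
    have e2 := sum_pairDist_mul M π d (fun z => x z.1 ⬝ᵥ y.1) fun z => x z.2 i - x z.1 i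
    have e3 := sum_pairDist_mul M π d (fun _ => 1) fun _ => 1
    rw [hone, mul_one] at e1 e3
    calc _ = -(∑ t, pairDist M π d t * ((x t.1.2 i - x t.1.1 i) * (x t.1.1 ⬝ᵥ y.1) * 1) -
          ∑ t, pairDist M π d t * ((x t.1.1 ⬝ᵥ y.1) * (x t.2.2 i - x t.2.1 i))) -
          (∑ t, pairDist M π d t * 1) * (η * y.2 i) := by
          simp only [Prod.snd_sum, Finset.sum_apply, Prod.smul_snd, gq2Drift, Pi.smul_apply,
            smul_eq_mul, ← Finset.sum_sub_distrib, Finset.sum_mul, ← Finset.sum_neg_distrib,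
            Pi.sub_apply]
          exact Finset.sum_congr rfl fun z _ => by ring
      _ = _ := by
          rw [e1, e2, e3, one_mul]
          change _ = -((A₂ M π d x)ᵀ *ᵥ y.1) i - η * y.2 i
          rw [A₂_transpose_mulVec_apply]

end Updates

/-! ### Lyapunov functions for the mean field -/

section Lyapunov

variable {K : ℕ}

/-- The symmetric bilinear form `⟪u, v⟫ - ε (⟪u₁, A v₂⟫ + ⟪v₁, A u₂⟫)` on pairs `(ν, w)`. -/
def crossForm (A : Matrix (Fin K) (Fin K) ℝ) (ε : ℝ) :
    LinearMap.BilinForm ℝ ((Fin K → ℝ) × (Fin K → ℝ)) :=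
  LinearMap.mk₂ ℝ
    (fun u v => u.1 ⬝ᵥ v.1 + u.2 ⬝ᵥ v.2 - ε * (u.1 ⬝ᵥ A *ᵥ v.2 + v.1 ⬝ᵥ A *ᵥ u.2))
    (fun u u' v => by simp [add_dotProduct, dotProduct_add, mulVec_add]; ring)
    (fun a u v => by simp [mulVec_smul]; ring)
    (fun u v v' => by simp [add_dotProduct, dotProduct_add, mulVec_add]; ring)
    (fun a u v => by simp [mulVec_smul]; ring)

theorem crossForm_apply (A : Matrix (Fin K) (Fin K) ℝ) (ε : ℝ) (u v) :
    crossForm A ε u v =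
      u.1 ⬝ᵥ v.1 + u.2 ⬝ᵥ v.2 - ε * (u.1 ⬝ᵥ A *ᵥ v.2 + v.1 ⬝ᵥ A *ᵥ u.2) := rfl

theorem two_mul_dotProduct_le (u v : Fin K → ℝ) : 2 * (u ⬝ᵥ v) ≤ u ⬝ᵥ u + v ⬝ᵥ v := by
  have h : 0 ≤ (u - v) ⬝ᵥ (u - v) := by simpa using dotProduct_star_self_nonneg (u - v)
  simp only [sub_dotProduct, dotProduct_sub, dotProduct_comm v u] at h
  linarith

theorem real_dotProduct_self_nonneg (u : Fin K → ℝ) : 0 ≤ u ⬝ᵥ u := by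
  simpa using dotProduct_star_self_nonneg u

theorem real_dotProduct_self_pos {u : Fin K → ℝ} (h : u ≠ 0) : 0 < u ⬝ᵥ u := by
  simpa using dotProduct_star_self_pos_iff.2 h

/-- Half the derivative of `y ↦ crossForm A ε y y` along the linear mean field of Diff-GQ2. -/
theorem crossForm_drift (A C : Matrix (Fin K) (Fin K) ℝ) (ε η : ℝ)
    (y : (Fin K → ℝ) × (Fin K → ℝ)) :
    crossForm A ε y (A *ᵥ y.2 - C *ᵥ y.1, -(Aᵀ *ᵥ y.1) - η • y.2) =
      -(y.1 ⬝ᵥ C *ᵥ y.1) - η * (y.2 ⬝ᵥ y.2) + ε * (Aᵀ *ᵥ y.1 ⬝ᵥ Aᵀ *ᵥ y.1) +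
        ε * η * (y.1 ⬝ᵥ A *ᵥ y.2) - ε * (A *ᵥ y.2 ⬝ᵥ A *ᵥ y.2) +
        ε * (C *ᵥ y.1 ⬝ᵥ A *ᵥ y.2) := by
  have h1 : y.2 ⬝ᵥ Aᵀ *ᵥ y.1 = y.1 ⬝ᵥ A *ᵥ y.2 := by
    rw [dotProduct_comm, mulVec_transpose, ← dotProduct_mulVec]
  have h2 : y.1 ⬝ᵥ A *ᵥ (Aᵀ *ᵥ y.1) = Aᵀ *ᵥ y.1 ⬝ᵥ Aᵀ *ᵥ y.1 := by
    rw [dotProduct_mulVec, ← mulVec_transpose]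
  rw [crossForm_apply]
  simp only [dotProduct_sub, sub_dotProduct, dotProduct_neg, dotProduct_smul, mulVec_sub,
    mulVec_neg, mulVec_smul, smul_eq_mul, h1, h2]
  ring

/-- A Lyapunov function for the mean field of Diff-GQ2. With regularization the Euclidean norm
works; without it a small cross term is added, which turns `A w` into a source of decay. -/
theorem exists_lyapunov {A C : Matrix (Fin K) (Fin K) ℝ} (hC : C.PosDef) {η : ℝ}
    (h : 0 < η ∨ η = 0 ∧ IsUnit A) :
    ∃ Q : LinearMap.BilinForm ℝ ((Fin K → ℝ) × (Fin K → ℝ)), (∀ u v, Q u v = Q v u) ∧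
      (∀ y, y ≠ 0 → 0 < Q y y) ∧
      ∀ y, y ≠ 0 → Q y (A *ᵥ y.2 - C *ᵥ y.1, -(Aᵀ *ᵥ y.1) - η • y.2) < 0 := by
  have hCpos : ∀ v : Fin K → ℝ, v ≠ 0 → 0 < v ⬝ᵥ C *ᵥ v := fun v hv => by
    simpa using hC.dotProduct_mulVec_pos hv
  have hCnn : ∀ v : Fin K → ℝ, 0 ≤ v ⬝ᵥ C *ᵥ v := fun v => by
    simpa using hC.posSemidef.dotProduct_mulVec_nonneg v
  have hsymm : ∀ ε u v, crossForm A ε u v = crossForm A ε v u := fun ε u v => by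
    simp only [crossForm_apply, dotProduct_comm u.1 v.1, dotProduct_comm u.2 v.2]
    ring
  have hne : ∀ y : (Fin K → ℝ) × (Fin K → ℝ), y ≠ 0 → y.1 ≠ 0 ∨ y.2 ≠ 0 := fun y hy => by
    by_contra! hc
    exact hy (Prod.ext hc.1 hc.2)
  rcases h with hη | ⟨rfl, hA⟩
  · refine ⟨crossForm A 0, hsymm 0, fun y hy => ?_, fun y hy => ?_⟩
    · rw [crossForm_apply]
      have h1 := real_dotProduct_self_nonneg y.1
      have h2 := real_dotProduct_self_nonneg y.2
      rcases hne y hy with h | h <;> have := real_dotProduct_self_pos h <;> linarith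
    · rw [crossForm_drift]
      have h1 := hCnn y.1
      have h2 := mul_nonneg hη.le (real_dotProduct_self_nonneg y.2)
      rcases hne y hy with h | h
      · have := hCpos _ h; linarith
      · have := mul_pos hη (real_dotProduct_self_pos h); linarith
  · obtain ⟨c₁, hc₁, h1⟩ := exists_le_mul_of_homogeneous
      (f := fun v : Fin K → ℝ => Aᵀ *ᵥ v ⬝ᵥ Aᵀ *ᵥ v + C *ᵥ v ⬝ᵥ C *ᵥ v)
      (g := fun v => v ⬝ᵥ C *ᵥ v) (by fun_prop) (by fun_prop)
      (fun s v => by simp [mulVec_smul]; ring) (fun s v => by simp [mulVec_smul]; ring) hCpos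
    obtain ⟨c₂, hc₂, h2⟩ := exists_le_mul_of_homogeneous
      (f := fun v : Fin K → ℝ => A *ᵥ v ⬝ᵥ A *ᵥ v)
      (g := fun v => v ⬝ᵥ v) (by fun_prop) (by fun_prop)
      (fun s v => by simp [mulVec_smul]; ring) (fun s v => by simp; ring)
      (fun v hv => real_dotProduct_self_pos hv)
    have hinj : ∀ v : Fin K → ℝ, v ≠ 0 → A *ᵥ v ≠ 0 := fun v hv h0 =>
      hv (mulVec_injective_of_isUnit hA (by simpa using h0))
    -- `ε c₁ < 1` keeps the decay in `ν`, `ε < 1` and `ε c₂ < 1` keep the form definite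
    set ε : ℝ := 1 / (1 + c₁ + c₂) with hε
    have hs : 0 < 1 + c₁ + c₂ := by positivity
    have hε0 : 0 < ε := by positivity
    have hεs : ε + ε * c₁ + ε * c₂ = 1 := by rw [hε]; field_simp
    have hεc₁ : 0 < ε * c₁ := by positivity
    have hεc₂ : 0 < ε * c₂ := by positivity
    refine ⟨crossForm A ε, hsymm ε, fun y hy => ?_, fun y hy => ?_⟩
    · rw [crossForm_apply]
      have e1 := real_dotProduct_self_nonneg y.1
      have e2 := real_dotProduct_self_nonneg y.2
      have e3 := mul_le_mul_of_nonneg_left (two_mul_dotProduct_le y.1 (A *ᵥ y.2)) hε0.le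
      have e4 := mul_le_mul_of_nonneg_left (h2 y.2) hε0.le
      have e5 : 0 < (1 - ε) * (y.1 ⬝ᵥ y.1) + (1 - ε * c₂) * (y.2 ⬝ᵥ y.2) := by
        have f1 : 0 < 1 - ε := by linarith
        have f2 : 0 < 1 - ε * c₂ := by linarith
        rcases hne y hy with h | h
        · exact add_pos_of_pos_of_nonneg (mul_pos f1 (real_dotProduct_self_pos h))
            (mul_nonneg f2.le e2)
        · exact add_pos_of_nonneg_of_pos (mul_nonneg f1.le e1)
            (mul_pos f2 (real_dotProduct_self_pos h))
      linarith
    · rw [crossForm_drift]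
      have e1 := hCnn y.1
      have e2 := real_dotProduct_self_nonneg (A *ᵥ y.2)
      have e3 := mul_le_mul_of_nonneg_left (two_mul_dotProduct_le (C *ᵥ y.1) (A *ᵥ y.2)) hε0.le
      have e4 := mul_le_mul_of_nonneg_left (h1 y.1) hε0.le
      have e5 := mul_nonneg hε0.le (real_dotProduct_self_nonneg (C *ᵥ y.1))
      have e6 : 0 < (1 - ε * c₁) * (y.1 ⬝ᵥ C *ᵥ y.1) + ε / 2 * (A *ᵥ y.2 ⬝ᵥ A *ᵥ y.2) := by
        have f1 : 0 < 1 - ε * c₁ := by linarith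
        rcases hne y hy with h | h
        · exact add_pos_of_pos_of_nonneg (mul_pos f1 (hCpos _ h))
            (mul_nonneg (half_pos hε0).le e2)
        · exact add_pos_of_nonneg_of_pos (mul_nonneg f1.le e1)
            (mul_pos (half_pos hε0) (real_dotProduct_self_pos (hinj _ h)))
      linarith

end Lyapunov

/-! ### Independence and law of the sample pairs -/

section Sampling

variable {S A Ω : Type*} [MeasurableSpace S] [MeasurableSpace A] [MeasurableSpace Ω]
  {z : ℕ → Fin 2 → Ω → Sample S A}

/-- The filtration of the past: the samples drawn strictly before step `k`. -/
def pastFiltration (hz : ∀ k i, Measurable (z k i)) : Filtration ℕ ‹MeasurableSpace Ω› where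
  seq k := ⨆ ki ∈ {ki : ℕ × Fin 2 | ki.1 < k}, MeasurableSpace.comap (z ki.1 ki.2) inferInstance
  mono' _ _ hkl := biSup_mono fun _ h => lt_of_lt_of_le h hkl
  le' _ := iSup₂_le fun _ _ => (hz _ _).comap_le

theorem measurable_pair_pastFiltration (hz : ∀ k i, Measurable (z k i)) (k : ℕ) :
    Measurable[pastFiltration hz (k + 1)] fun ω => (z k 0 ω, z k 1 ω) := by
  have h : ∀ i, Measurable[pastFiltration hz (k + 1)] (z k i) := fun i =>
    measurable_iff_comap_le.2 (le_biSup (fun ki : ℕ × Fin 2 =>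
      MeasurableSpace.comap (z ki.1 ki.2) inferInstance)
      (show (k, i) ∈ {ki : ℕ × Fin 2 | ki.1 < k + 1} from Nat.lt_succ_self k))
  exact (h 0).prodMk (h 1)

variable [Fintype S] [Fintype A] {M : MDP S A} {π : Policy S A} {d : S × A → ℝ} {Pr : Measure Ω}

theorem DiffGQ.IsIIDSample.indep_pastFiltration (h : IsIIDSample M π d Pr z) (k : ℕ) :
    Indep (MeasurableSpace.comap (fun ω => (z k 0 ω, z k 1 ω)) inferInstance)
      (pastFiltration h.measurable k) Pr := by
  have hdisj : Disjoint {ki : ℕ × Fin 2 | ki.1 = k} {ki : ℕ × Fin 2 | ki.1 < k} :=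
    Set.disjoint_left.2 fun ki h1 h2 => (Nat.ne_of_lt h2) h1
  have hind := indep_iSup_of_disjoint
    (m := fun ki : ℕ × Fin 2 => MeasurableSpace.comap (z ki.1 ki.2) inferInstance)
    (fun ki => (h.measurable _ _).comap_le) h.indep hdisj
  refine indep_of_indep_of_le_left hind (measurable_iff_comap_le.1 ?_)
  have hm : ∀ i, Measurable[⨆ ki ∈ {ki : ℕ × Fin 2 | ki.1 = k},
      MeasurableSpace.comap (z ki.1 ki.2) inferInstance] (z k i) := fun i =>
    measurable_iff_comap_le.2 (le_biSup (fun ki : ℕ × Fin 2 =>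
      MeasurableSpace.comap (z ki.1 ki.2) inferInstance)
      (show (k, i) ∈ {ki : ℕ × Fin 2 | ki.1 = k} from rfl))
  exact (hm 0).prodMk (hm 1)

theorem DiffGQ.IsIIDSample.measureReal_pair [MeasurableSingletonClass S]
    [MeasurableSingletonClass A] (h : IsIIDSample M π d Pr z) (k : ℕ)
    (t : Sample S A × Sample S A) :
    Pr.real ((fun ω => (z k 0 ω, z k 1 ω)) ⁻¹' {t}) = pairDist M π d t := by
  have hset : (fun ω => (z k 0 ω, z k 1 ω)) ⁻¹' {t} = z k 0 ⁻¹' {t.1} ∩ z k 1 ⁻¹' {t.2} := by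
    ext ω; simp [Prod.ext_iff]
  have hi : IndepFun (z k 0) (z k 1) Pr :=
    h.indep.indepFun (i := (k, 0)) (j := (k, 1)) (by simp)
  rw [hset, measureReal_def, hi.measure_inter_preimage_eq_mul _ _ (measurableSet_singleton _)
    (measurableSet_singleton _), ENNReal.toReal_mul, pairDist, ← h.law k 0, ← h.law k 1]
  rfl

end Sampling

/-! ### Almost sure convergence of the iterates -/

section Convergence

variable {S A Ω : Type*} [Fintype S] [Fintype A]
  [MeasurableSpace S] [MeasurableSingletonClass S] [MeasurableSpace A] [MeasurableSingletonClass A]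
  [MeasurableSpace Ω] {M : MDP S A} {π : Policy S A} {d : S × A → ℝ} {Pr : Measure Ω} {K : ℕ}
  {x : S × A → Fin K → ℝ} {z : ℕ → Fin 2 → Ω → Sample S A} {α β : ℕ → ℝ}

/-- The reward-rate estimate follows the weights. At the limit point `w` the recursion averages
i.i.d. samples of mean `rateOf w`; the effect of `wₖ ≠ w` is a pathwise null perturbation. -/
theorem ae_tendsto_rhat [IsProbabilityMeasure Pr] (hd_pos : ∀ sa, 0 < d sa) (hd : ∑ sa, d sa = 1)
    (h : IsIIDSample M π d Pr z) (hβ : IsStepsize β) {η : ℝ} {w : Fin K → ℝ} (init : Iterate K)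
    (hw : ∀ᵐ ω ∂Pr, Tendsto (fun k => (gq2Iter M x η α β (fun k i => z k i ω) init k).w) atTop
      (𝓝 w)) :
    ∀ᵐ ω ∂Pr, Tendsto (fun k => (gq2Iter M x η α β (fun k i => z k i ω) init k).rhat) atTop
      (𝓝 (rateOf M π d x w)) := by
  set ρ := rateOf M π d x w with hρ
  set R : Sample S A × Sample S A → (Fin K → ℝ) → ℝ := fun t v =>
    (1 / 2) * (tdTerm M x t.1 v + tdTerm M x t.2 v) with hR
  have hcenter : ∑ t, pairDist M π d t • (R t w - ρ) = 0 := by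
    have h1 := sum_sampleDist M π d hd
    have e1 := sum_pairDist_mul M π d (fun s => tdTerm M x s w) fun _ => 1
    have e2 := sum_pairDist_mul M π d (fun _ => 1) fun s => tdTerm M x s w
    have e3 := sum_pairDist M π d hd
    simp only [mul_one, one_mul, h1, sum_sampleDist_tdTerm_one, ← hρ] at e1 e2
    have : ∑ t, pairDist M π d t • (R t w - ρ) =
        (1 / 2) * (∑ t, pairDist M π d t * tdTerm M x t.1 w) +
        (1 / 2) * (∑ t, pairDist M π d t * tdTerm M x t.2 w) - (∑ t, pairDist M π d t) * ρ := by
      rw [Finset.mul_sum, Finset.mul_sum, Finset.sum_mul, ← Finset.sum_add_distrib,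
        ← Finset.sum_sub_distrib]
      exact Finset.sum_congr rfl fun t _ => by rw [smul_eq_mul, hR]; ring
    rw [this, e1, e2, e3]
    ring
  have hnoise := ae_tendsto_zero_of_linear (measurable_pair_pastFiltration h.measurable)
    h.indep_pastFiltration h.measureReal_pair (pairDist_nonneg M π d hd_pos)
    (sum_pairDist M π d hd) hβ
    (fun _ => (-LinearMap.id : ℝ →ₗ[ℝ] ℝ)) (fun t => R t w - ρ) hcenter (LinearMap.mul ℝ ℝ)
    (fun u v => mul_comm u v) (fun y hy => mul_self_pos.2 hy)
    (fun y hy => by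
      have e3 := sum_pairDist M π d hd
      rw [← Finset.sum_smul, e3]
      simpa using hy) 0
  filter_upwards [hnoise, hw] with ω h1 h2
  set it := gq2Iter M x η α β (fun k i => z k i ω) init with hit
  set a := randomRec (fun k (t : Sample S A × Sample S A) y =>
    y + β k • ((-LinearMap.id : ℝ →ₗ[ℝ] ℝ) y + (R t w - ρ))) 0 fun j => (z j 0 ω, z j 1 ω) with ha
  have hR0 : Tendsto (fun k => R (z k 0 ω, z k 1 ω) (it k).w - R (z k 0 ω, z k 1 ω) w) atTop
      (𝓝 0) := by
    have hc : ∀ t, Continuous fun v => R t v := fun t => by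
      simp only [hR, tdTerm]; fun_prop
    have hall : Tendsto (fun k => ∑ t, |R t (it k).w - R t w|) atTop (𝓝 0) := by
      have : ∀ t, Tendsto (fun k => |R t (it k).w - R t w|) atTop (𝓝 0) := fun t => by
        simpa using ((((hc t).tendsto w).comp h2).sub_const (R t w)).abs
      simpa using tendsto_finsetSum Finset.univ fun t _ => this t
    refine squeeze_zero_norm (fun k => ?_) hall
    exact Finset.single_le_sum (f := fun t => |R t (it k).w - R t w|)
      (fun t _ => abs_nonneg _) (Finset.mem_univ (z k 0 ω, z k 1 ω))
  have hb := tendsto_zero_of_averaging (b := fun k => (it k).rhat - ρ - a k)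
    (fun k => (hβ.pos k).le) hβ.tendsto_zero hβ.not_summable (fun k => by
      have e1 : (it (k + 1)).rhat =
          (it k).rhat + β k * (R (z k 0 ω, z k 1 ω) (it k).w - (it k).rhat) := rfl
      have e2 : a (k + 1) = a k + β k * (-a k + (R (z k 0 ω, z k 1 ω) w - ρ)) := rfl
      rw [e1, e2]
      ring) hR0
  have h3 := (hb.add h1).add_const ρ
  simpa using h3

variable [DecidableEq S] [DecidableEq A]

/-- Almost sure convergence of the weights to `w`, where `(ν, w)` is a zero of the mean field. -/
theorem ae_tendsto_w [IsProbabilityMeasure Pr] (hd_pos : ∀ sa, 0 < d sa) (hd : ∑ sa, d sa = 1)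
    (hC : (C₂ d x).PosDef) (h : IsIIDSample M π d Pr z) (hα : IsStepsize α) {η : ℝ}
    (hη : 0 < η ∨ η = 0 ∧ IsUnit (A₂ M π d x)) {ν w : Fin K → ℝ}
    (hν : A₂ M π d x *ᵥ w + b₂ M d x - C₂ d x *ᵥ ν = 0)
    (hw : -((A₂ M π d x)ᵀ *ᵥ ν) - η • w = 0) (init : Iterate K) :
    ∀ᵐ ω ∂Pr, Tendsto (fun k => (gq2Iter M x η α β (fun k i => z k i ω) init k).w) atTop
      (𝓝 w) := by
  obtain ⟨Q, hsymm, hQ, hdrift⟩ := exists_lyapunov (A := A₂ M π d x) hC hη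
  have hcenter : ∑ t, pairDist M π d t • gq2Drift M x η t (ν, w) = 0 := by
    rw [sum_pairDist_gq2Drift M π d x hd, Prod.mk_eq_zero]
    exact ⟨hν, hw⟩
  have hmean : ∀ u, ∑ t, pairDist M π d t • gq2Linear x η t u =
      (A₂ M π d x *ᵥ u.2 - C₂ d x *ᵥ u.1, -((A₂ M π d x)ᵀ *ᵥ u.1) - η • u.2) := fun u => by
    have h1 : ∑ t, pairDist M π d t • gq2Linear x η t u =
        ∑ t, pairDist M π d t • gq2Drift M x η t ((ν, w) + u) -
          ∑ t, pairDist M π d t • gq2Drift M x η t (ν, w) := by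
      rw [← Finset.sum_sub_distrib]
      exact Finset.sum_congr rfl fun t _ => by rw [gq2Drift_add, smul_add, add_sub_cancel_right]
    rw [h1, sum_pairDist_gq2Drift M π d x hd, sum_pairDist_gq2Drift M π d x hd, Prod.mk_sub_mk]
    simp only [Prod.fst_add, Prod.snd_add, mulVec_add, smul_add]
    congr 1 <;> abel
  filter_upwards [ae_tendsto_zero_of_linear (measurable_pair_pastFiltration h.measurable)
    h.indep_pastFiltration h.measureReal_pair (pairDist_nonneg M π d hd_pos)
    (sum_pairDist M π d hd) hα
    (gq2Linear x η) (fun t => gq2Drift M x η t (ν, w)) hcenter Q hsymm hQ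
    (fun u hu => by rw [hmean]; exact hdrift u hu) ((init.ν, init.w) - (ν, w))] with ω hω
  have h1 := (hω.const_add (ν, w)).congr fun k =>
    (gq2Iter_eq_randomRec M x (α := α) (β := β) η (ν, w) init
      (fun k i => z k i ω) k).symm
  rw [add_zero] at h1
  exact (continuous_snd.tendsto _).comp h1

end Convergence

/-! ### The regularized objective and its minimizer -/

section Objective

variable {S A : Type*} [Fintype S] [Fintype A] [DecidableEq S] [DecidableEq A] {K : ℕ}
  (M : MDP S A) (π : Policy S A) (d : S × A → ℝ) (x : S × A → Fin K → ℝ)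

theorem J₂_eq (η : ℝ) (w : Fin K → ℝ) :
    J₂ M π d x η w = (A₂ M π d x *ᵥ w + b₂ M d x) ⬝ᵥ
      ((C₂ d x)⁻¹ *ᵥ (A₂ M π d x *ᵥ w + b₂ M d x)) + η * (w ⬝ᵥ w) := by
  rw [A₂_mulVec_add_b₂, ← l2norm_sq]
  rfl

variable {d x}

theorem regMatrix_posDef (hC : (C₂ d x).PosDef) {η : ℝ} (hη : 0 < η) :
    (regMatrix M π d x η).PosDef := by
  refine (PosDef.one.smul hη).add_posSemidef ?_
  simpa using hC.inv.posSemidef.conjTranspose_mul_mul_same (A₂ M π d x)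

theorem regMatrix_mulVec_wStar (hC : (C₂ d x).PosDef) {η : ℝ} (hη : 0 < η) :
    regMatrix M π d x η *ᵥ wStar M π d x η =
      -((A₂ M π d x)ᵀ *ᵥ ((C₂ d x)⁻¹ *ᵥ b₂ M d x)) := by
  have hu := (isUnit_iff_isUnit_det _).1 (regMatrix_posDef M π hC hη).isUnit
  rw [wStar, mulVec_neg, mulVec_mulVec, ← Matrix.mul_assoc, ← Matrix.mul_assoc,
    Matrix.mul_nonsing_inv _ hu, Matrix.one_mul, mulVec_mulVec]

/-- Stationarity of the objective at `w*_η`. -/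
theorem wStar_stationary (hC : (C₂ d x).PosDef) {η : ℝ} (hη : 0 < η) :
    (A₂ M π d x)ᵀ *ᵥ ((C₂ d x)⁻¹ *ᵥ (A₂ M π d x *ᵥ wStar M π d x η + b₂ M d x)) +
      η • wStar M π d x η = 0 := by
  have h := regMatrix_mulVec_wStar M π hC hη
  rw [regMatrix, add_mulVec, smul_mulVec, one_mulVec, ← mulVec_mulVec, ← mulVec_mulVec] at h
  rw [mulVec_add, mulVec_add, add_right_comm, add_comm _ (η • _), h, neg_add_cancel]

theorem J₂_wStar_lt (hC : (C₂ d x).PosDef) {η : ℝ} (hη : 0 < η) {w : Fin K → ℝ}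
    (hw : w ≠ wStar M π d x η) : J₂ M π d x η (wStar M π d x η) < J₂ M π d x η w := by
  obtain ⟨u, rfl⟩ : ∃ u, w = wStar M π d x η + u := ⟨w - wStar M π d x η, by abel⟩
  have hu : u ≠ 0 := fun h => hw (by rw [h, add_zero])
  have hst := wStar_stationary M π hC hη
  set w := wStar M π d x η
  set G := (C₂ d x)⁻¹ with hG
  set c := A₂ M π d x *ᵥ w + b₂ M d x with hc
  set a := A₂ M π d x *ᵥ u with ha
  have hGt : Gᵀ = G := by
    simpa using hC.inv.isHermitian.eq
  have hsymm : c ⬝ᵥ G *ᵥ a = a ⬝ᵥ G *ᵥ c := by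
    rw [dotProduct_mulVec, ← mulVec_transpose, hGt, dotProduct_comm]
  have hcross : a ⬝ᵥ G *ᵥ c + η * (u ⬝ᵥ w) = 0 := by
    have h1 : u ⬝ᵥ ((A₂ M π d x)ᵀ *ᵥ (G *ᵥ c) + η • w) = 0 := by rw [hst, dotProduct_zero]
    rw [dotProduct_add, dotProduct_smul, smul_eq_mul, dotProduct_mulVec, vecMul_transpose] at h1
    exact h1
  have ha0 : 0 ≤ a ⬝ᵥ G *ᵥ a := by
    simpa using hC.inv.posSemidef.dotProduct_mulVec_nonneg a
  have hu0 : 0 < η * (u ⬝ᵥ u) := mul_pos hη (real_dotProduct_self_pos hu)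
  have hsum : A₂ M π d x *ᵥ (w + u) + b₂ M d x = c + a := by
    rw [hc, ha, mulVec_add]; abel
  rw [J₂_eq, J₂_eq, hsum, ← hG, ← hc]
  simp only [mulVec_add, dotProduct_add, add_dotProduct, hsymm, dotProduct_comm w u]
  linarith

end Objective

/-! ### Minimizer, limit of vanishing regularization, and convergence of Diff-GQ2 -/

theorem theorem2 {S A : Type*} [Fintype S] [Fintype A] [DecidableEq S] [DecidableEq A]
    [MeasurableSpace S] [MeasurableSingletonClass S]
    [MeasurableSpace A] [MeasurableSingletonClass A]
    {K : ℕ} (M : MDP S A) (π : Policy S A) (d : S × A → ℝ) (x : S × A → Fin K → ℝ)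
    (hchain : IsUnichain (stateMatrix M π))
    (hd_pos : ∀ sa, 0 < d sa) (hd_sum : ∑ sa, d sa = 1)
    (hX : LinearIndependent ℝ (fun j : Fin K => fun sa => featureMatrix x sa j)) :
    -- `w*_η` is well defined and is the unique minimizer of the objective
    (IsUnit (C₂ d x) ∧
      ∀ η : ℝ, 0 < η → IsUnit (regMatrix M π d x η) ∧
        ∀ w, w ≠ wStar M π d x η → J₂ M π d x η (wStar M π d x η) < J₂ M π d x η w) ∧
    -- the limit `w*_0` as `η ↓ 0`
    (∃ w₀ : Fin K → ℝ,
      Tendsto (fun η => wStar M π d x η) (𝓝[>] 0) (𝓝 w₀) ∧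
      (∃ U₀ : ℝ, ∀ η : ℝ, 0 < η → l2norm (wStar M π d x η - w₀) ≤ η * U₀) ∧
      (∃ H N : Matrix (Fin K) (Fin K) ℝ, H.PosDef ∧ H * H = (C₂ d x)⁻¹ ∧
        IsMoorePenrose (H * A₂ M π d x) N ∧ w₀ = -(N *ᵥ (H *ᵥ b₂ M d x))) ∧
      ((∃ rhat w, IsTDFixedPoint M π d x rhat w) →
        A₂ M π d x *ᵥ w₀ + b₂ M d x = 0)) ∧
    -- if `A₂` is invertible, `(r̂_TD, w_TD)` is the unique TD fixed point
    (IsUnit (A₂ M π d x) → ∀ rhat w,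
      IsTDFixedPoint M π d x rhat w ↔ rhat = rTD M π d x ∧ w = wTD M π d x) ∧
    -- almost sure convergence of the iterates
    (∀ (Ω : Type*) [MeasurableSpace Ω] (Pr : Measure Ω) [IsProbabilityMeasure Pr]
      (z : ℕ → Fin 2 → Ω → Sample S A), IsIIDSample M π d Pr z →
      ∀ α β : ℕ → ℝ, IsStepsize α → IsStepsize β → ∀ init : Iterate K,
        (∀ η : ℝ, 0 < η → ∀ᵐ ω ∂Pr,
          Tendsto (fun k => (gq2Iter M x η α β (fun k i => z k i ω) init k).w) atTop
            (𝓝 (wStar M π d x η)) ∧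
          Tendsto (fun k => (gq2Iter M x η α β (fun k i => z k i ω) init k).rhat) atTop
            (𝓝 (rateOf M π d x (wStar M π d x η)))) ∧
        (IsUnit (A₂ M π d x) → ∀ᵐ ω ∂Pr,
          Tendsto (fun k => (gq2Iter M x 0 α β (fun k i => z k i ω) init k).w) atTop
            (𝓝 (wTD M π d x)) ∧
          Tendsto (fun k => (gq2Iter M x 0 α β (fun k i => z k i ω) init k).rhat) atTop
            (𝓝 (rTD M π d x)))) := by
  have hC := C₂_posDef d x hd_pos hX
  have hCu := (isUnit_iff_isUnit_det _).1 hC.isUnit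
  have hAwTD : IsUnit (A₂ M π d x) → A₂ M π d x *ᵥ wTD M π d x + b₂ M d x = 0 := fun hA => by
    rw [wTD, mulVec_neg, mulVec_mulVec,
      Matrix.mul_nonsing_inv _ ((isUnit_iff_isUnit_det _).1 hA), one_mulVec, neg_add_cancel]
  refine ⟨⟨hC.isUnit, fun η hη => ⟨(regMatrix_posDef M π hC hη).isUnit,
    fun w hw => J₂_wStar_lt M π hC hη hw⟩⟩, ?_, ?_, ?_⟩
  · obtain ⟨H, hH, hHH⟩ := hC.inv.exists_posDef_sqrt
    obtain ⟨N, hN⟩ := exists_isMoorePenrose (H * A₂ M π d x)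
    have hHt : Hᵀ = H := by simpa using hH.isHermitian.eq
    set h := H *ᵥ b₂ M d x with hh
    have hBB : (H * A₂ M π d x)ᵀ * (H * A₂ M π d x) =
        (A₂ M π d x)ᵀ * (C₂ d x)⁻¹ * A₂ M π d x := by
      rw [transpose_mul, hHt, ← hHH]; simp only [Matrix.mul_assoc]
    have hBh : (H * A₂ M π d x)ᵀ *ᵥ h = (A₂ M π d x)ᵀ *ᵥ ((C₂ d x)⁻¹ *ᵥ b₂ M d x) := by
      rw [transpose_mul, hHt, ← hHH, hh]
      simp only [mulVec_mulVec, Matrix.mul_assoc]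
    have hbound : ∀ η : ℝ, 0 < η → l2norm (wStar M π d x η - -(N *ᵥ h)) ≤
        η * l2norm ((N * Nᵀ * N) *ᵥ h) := fun η hη => by
      have e : wStar M π d x η - -(N *ᵥ h) =
          -((η • (1 : Matrix (Fin K) (Fin K) ℝ) + (H * A₂ M π d x)ᵀ * (H * A₂ M π d x))⁻¹ *ᵥ
            ((H * A₂ M π d x)ᵀ *ᵥ h) - N *ᵥ h) := by
        rw [hBB, hBh, wStar, regMatrix]
        simp only [← mulVec_mulVec]
        abel
      rw [e]
      have e2 : ∀ v : Fin K → ℝ, l2norm (-v) = l2norm v := fun v => by simp [l2norm]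
      rw [e2]
      exact l2norm_ridge_sub_le hN hη h
    refine ⟨-(N *ᵥ h), ?_, ⟨_, hbound⟩, ⟨H, N, hH, hHH, hN, rfl⟩, ?_⟩
    · have h1 : Tendsto (fun η : ℝ => η * l2norm ((N * Nᵀ * N) *ᵥ h)) (𝓝[>] 0) (𝓝 0) := by
        have : Tendsto (fun η : ℝ => η * l2norm ((N * Nᵀ * N) *ᵥ h)) (𝓝 0)
            (𝓝 (0 * l2norm ((N * Nᵀ * N) *ᵥ h))) := by
          exact (continuous_id.mul continuous_const).tendsto 0
        rw [zero_mul] at this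
        exact this.mono_left nhdsWithin_le_nhds
      have h2 : Tendsto (fun η => WithLp.toLp 2 (wStar M π d x η - -(N *ᵥ h))) (𝓝[>] 0)
          (𝓝 0) :=
        squeeze_zero_norm' (by
          filter_upwards [self_mem_nhdsWithin] with η hη using hbound η hη) h1
      have h3 := ((PiLp.continuous_ofLp 2 fun _ : Fin K => ℝ).tendsto _).comp h2
      have h4 := h3.add_const (-(N *ᵥ h))
      simpa [Function.comp_def] using h4
    · rintro ⟨rhat, w, hw⟩
      have hw0 := ((isTDFixedPoint_iff M π d x hd_sum rhat w).1 hw).2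
      have hb : b₂ M d x = -(A₂ M π d x *ᵥ w) := (neg_eq_of_add_eq_zero_right hw0).symm
      have hhB : h = -((H * A₂ M π d x) *ᵥ w) := by
        rw [hh, hb, mulVec_neg, mulVec_mulVec]
      have h1 : (H * A₂ M π d x) *ᵥ (-(N *ᵥ h)) + h = 0 := by
        rw [mulVec_neg, mulVec_mulVec, hhB, mulVec_neg, mulVec_mulVec, hN.mul_mul_left]
        abel
      have h2 : H *ᵥ (A₂ M π d x *ᵥ (-(N *ᵥ h)) + b₂ M d x) = H *ᵥ 0 := by
        rw [mulVec_add, mulVec_mulVec, ← hh, h1, mulVec_zero]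
      exact mulVec_injective_of_isUnit hH.isUnit h2
  · intro hA rhat w
    rw [isTDFixedPoint_iff M π d x hd_sum]
    constructor
    · rintro ⟨h1, h2⟩
      have h3 : w = wTD M π d x := by
        refine mulVec_injective_of_isUnit hA (add_right_cancel (b := b₂ M d x) ?_)
        rw [h2, hAwTD hA]
      subst h3
      exact ⟨h1, rfl⟩
    · rintro ⟨rfl, rfl⟩
      exact ⟨rfl, hAwTD hA⟩
  · intro Ω _ Pr _ z hz α β hα hβ init
    refine ⟨fun η hη => ?_, fun hA => ?_⟩
    · have hst := wStar_stationary M π hC hη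
      have hw := ae_tendsto_w (β := β) hd_pos hd_sum hC hz hα (Or.inl hη)
        (ν := (C₂ d x)⁻¹ *ᵥ (A₂ M π d x *ᵥ wStar M π d x η + b₂ M d x)) (w := wStar M π d x η)
        (by rw [mulVec_mulVec, Matrix.mul_nonsing_inv _ hCu, one_mulVec, sub_self])
        (by rw [← neg_add', hst, neg_zero]) init
      filter_upwards [hw, ae_tendsto_rhat hd_pos hd_sum hz hβ init hw] with ω h1 h2 using ⟨h1, h2⟩
    · have hw := ae_tendsto_w (β := β) hd_pos hd_sum hC hz hα (Or.inr ⟨rfl, hA⟩)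
        (ν := 0) (w := wTD M π d x) (by rw [hAwTD hA, mulVec_zero, sub_self])
        (by simp) init
      filter_upwards [hw, ae_tendsto_rhat hd_pos hd_sum hz hβ init hw] with ω h1 h2 using ⟨h1, h2⟩
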